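/- Let $d\in\mathbb N$ and $s>0$, and let $\gamma$ be the standard Gaussian measure on $\mathbb R^d$, with Lebesgue density $(2\pi)^{-d/2}e^{-|x|^2/2}$; functions are real-valued. For $n\in\mathbb N_0$ let $W^n_2(\mathbb R^d,\gamma)$ be the space of all $f\in L_2(\mathbb R^d,\gamma)$ whose generalized (weak) partial derivatives $D^\alpha f$ belong to $L_2(\mathbb R^d,\gamma)$ for all $\alpha\in\mathbb N_0^d$ with $|\alpha|_1\le n$, with norm $$\|f\|_{W^n_2(\mathbb R^d,\gamma)}=\Big(\sum_{|\alpha|_1\le n}\|D^\alpha f\|_{L_2(\mathbb R^d,\gamma)}^2\Big)^{1/2}.$$ For $t>0$ and $\sigma>0$ put $$M_t(x,y)=\frac1{(1-e^{-2t})^{d/2}}\exp\Big(-\frac{e^{-2t}|x|^2-2e^{-t}x\cdot y+e^{-2t}|y|^2}{2(1-e^{-2t})}\Big),\qquad K_\sigma(x,y)=\int_0^\infty\frac{M_t(x,y)}{t^{\sigma/2+1}}\,dt.$$ For $s\notin\mathbb N$ write $s=\bar s+\tilde s$ with $\bar s=\lfloor s\rfloor$, and let $W^s_2(\mathbb R^d,\gamma)$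 be the space of all $f\in W^{\bar s}_2(\mathbb R^d,\gamma)$ with $$[f]_{W^s_2(\mathbb R^d,\gamma)}=\sum_{|\alpha|_1=\bar s}\Big(\int_{\mathbb R^d}\int_{\mathbb R^d}|D^\alpha f(x)-D^\alpha f(y)|^2K_{2\tilde s}(x,y)\,d\gamma(x)\,d\gamma(y)\Big)^{1/2}<\infty,$$ with norm $\|f\|_{W^s_2(\mathbb R^d,\gamma)}=\|f\|_{W^{\bar s}_2(\mathbb R^d,\gamma)}+[f]_{W^s_2(\mathbb R^d,\gamma)}$. For $k\in\mathbb N_0^d$ let $H_k(x)=\prod_{j=1}^d H_{k_j}(x_j)$, where $H_m(x)=\frac{(-1)^m}{\sqrt{m!}}e^{x^2/2}\frac{d^m}{dx^m}e^{-x^2/2}$ for $m\in\mathbb N_0$, and for $f\in L_2(\mathbb R^d,\gamma)$ let $\widehat f(k)=\int_{\mathbb R^d}f H_k\,d\gamma$. Let $H^s(\mathbb R^d,\gamma)$ be the space of all $f\in L_2(\mathbb R^d,\gamma)$ such that $f=\sum_{k\in\mathbb N_0^d}\widehat f(k)H_k$ with convergence in $L_2(\mathbb R^d,\gamma)$ and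 $$\|f\|_{H^s(\mathbb R^d,\gamma)}=\Big(\sum_{k\in\mathbb N_0^d}(1+|k|_1)^s|\widehat f(k)|^2\Big)^{1/2}<\infty.$$ Then $W^s_2(\mathbb R^d,\gamma)=H^s(\mathbb R^d,\gamma)$ with equivalent norms: the two spaces consist of the same functions, and there are constants $c,C>0$, depending only on $d$ and $s$, such that $$c\,\|f\|_{H^s(\mathbb R^d,\gamma)}\le\|f\|_{W^s_2(\mathbb R^d,\gamma)}\le C\,\|f\|_{H^s(\mathbb R^d,\gamma)}\qquad\text{for all } f\in W^s_2(\mathbb R^d,\gamma).$$ -/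

import Mathlib

open MeasureTheory Filter Topology
open scoped ENNReal ContDiff Nat

noncomputable section

namespace GaussianSobolev

/-- The Euclidean space `ℝ^d`. -/
abbrev E (d : ℕ) : Type := EuclideanSpace ℝ (Fin d)

/-- The density `(2π)^(-d/2) exp(-|x|²/2)`. -/
def gaussDensity (d : ℕ) (x : E d) : ℝ :=
  (2 * Real.pi) ^ (-(d : ℝ) / 2) * Real.exp (-‖x‖ ^ 2 / 2)

/-- The standard Gaussian measure on `ℝ^d`, given by its Lebesgue density. -/
def gauss (d : ℕ) : Measure (E d) :=
  volume.withDensity fun x => ENNReal.ofReal (gaussDensity d x)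

/-- The length `|α|₁` of a multi-index. -/
def multiAbs {d : ℕ} (α : Fin d → ℕ) : ℕ := ∑ i, α i

/-- The multi-indices with `|α|₁ ≤ n`. -/
def multiLE (d n : ℕ) : Finset (Fin d → ℕ) :=
  (Fintype.piFinset fun _ : Fin d => Finset.range (n + 1)).filter fun α => multiAbs α ≤ n

/-- The multi-indices with `|α|₁ = n`. -/
def multiEQ (d n : ℕ) : Finset (Fin d → ℕ) :=
  (Fintype.piFinset fun _ : Fin d => Finset.range (n + 1)).filter fun α => multiAbs α = n

theorem mem_multiLE {d n : ℕ} {α : Fin d → ℕ} : α ∈ multiLE d n ↔ multiAbs α ≤ n := by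
  simp only [multiLE, Finset.mem_filter, Fintype.mem_piFinset, Finset.mem_range,
    and_iff_right_iff_imp]
  intro h i
  exact Nat.lt_succ_of_le
    ((Finset.single_le_sum (f := α) (fun _ _ => Nat.zero_le _) (Finset.mem_univ i)).trans h)

theorem mem_multiEQ {d n : ℕ} {α : Fin d → ℕ} : α ∈ multiEQ d n ↔ multiAbs α = n := by
  simp only [multiEQ, Finset.mem_filter, Fintype.mem_piFinset, Finset.mem_range,
    and_iff_right_iff_imp]
  intro h i
  exact Nat.lt_succ_of_le
    ((Finset.single_le_sum (f := α) (fun _ _ => Nat.zero_le _) (Finset.mem_univ i)).trans h.le)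

/-- The classical partial derivative in the `i`-th coordinate. -/
def partialDeriv {d : ℕ} (i : Fin d) (η : E d → ℝ) : E d → ℝ :=
  fun x => fderiv ℝ η x (EuclideanSpace.single i 1)

/-- The classical derivative `∂₁^{α₁} ⋯ ∂_d^{α_d} η`. -/
def multiDeriv {d : ℕ} (α : Fin d → ℕ) (η : E d → ℝ) : E d → ℝ :=
  (List.finRange d).foldr (fun i ψ => (partialDeriv i)^[α i] ψ) η

/-- `g` is a generalized (weak) partial derivative `D^α f` on `ℝ^d`. -/
def IsWeakDeriv {d : ℕ} (α : Fin d → ℕ) (f g : E d → ℝ) : Prop :=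
  LocallyIntegrable f ∧ LocallyIntegrable g ∧
    ∀ η : E d → ℝ, ContDiff ℝ ∞ η → HasCompactSupport η →
      ∫ x, f x * multiDeriv α η x = (-1) ^ multiAbs α * ∫ x, g x * η x

open scoped Classical in
/-- A representative of the generalized derivative `D^α f` (unique almost everywhere),
and `0` if there is none. -/
def weakDeriv {d : ℕ} (α : Fin d → ℕ) (f : E d → ℝ) : E d → ℝ :=
  if h : ∃ g, IsWeakDeriv α f g then h.choose else 0

/-- The Gaussian Sobolev space `W^n_2(ℝ^d, γ)` of integer order `n` (it is `L_2` for `n = 0`). -/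
def intSobolevSpace (d n : ℕ) : Set (E d → ℝ) :=
  {f | MemLp f 2 (gauss d) ∧ ∀ α : Fin d → ℕ, multiAbs α ≤ n →
    ∃ g, IsWeakDeriv α f g ∧ MemLp g 2 (gauss d)}

/-- The norm `(∑_{|α|₁ ≤ n} ‖D^α f‖²)^(1/2)` of `W^n_2(ℝ^d, γ)`. -/
def intSobolevNorm (d n : ℕ) (f : E d → ℝ) : ℝ :=
  Real.sqrt (∑ α ∈ multiLE d n, (eLpNorm (weakDeriv α f) 2 (gauss d)).toReal ^ 2)

/-- The Mehler kernel `M_t(x, y)`. -/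
def mehler {d : ℕ} (t : ℝ) (x y : E d) : ℝ :=
  1 / (1 - Real.exp (-2 * t)) ^ ((d : ℝ) / 2) *
    Real.exp (-((Real.exp (-2 * t) * ‖x‖ ^ 2 - 2 * Real.exp (-t) * inner ℝ x y
      + Real.exp (-2 * t) * ‖y‖ ^ 2) / (2 * (1 - Real.exp (-2 * t)))))

/-- The fractional Ornstein–Uhlenbeck kernel `K_σ(x, y) = ∫_0^∞ M_t(x, y) / t^(σ/2 + 1) dt`,
with values in `[0, ∞]` (it is infinite on the diagonal). -/
def ouKernel {d : ℕ} (σ : ℝ) (x y : E d) : ℝ≥0∞ :=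
  ∫⁻ t in Set.Ioi (0 : ℝ), ENNReal.ofReal (mehler t x y / t ^ (σ / 2 + 1))

/-- The seminorm of `W^s_2(ℝ^d, γ)` for non-integer `s`, with values in `[0, ∞]`. -/
def fracSeminorm (d : ℕ) (s : ℝ) (f : E d → ℝ) : ℝ≥0∞ :=
  ∑ α ∈ multiEQ d ⌊s⌋₊,
    (∫⁻ x, ∫⁻ y, ENNReal.ofReal (|weakDeriv α f x - weakDeriv α f y| ^ 2)
      * ouKernel (2 * Int.fract s) x y ∂(gauss d) ∂(gauss d)) ^ (1 / 2 : ℝ)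

/-- The Gaussian Sobolev space `W^s_2(ℝ^d, γ)`, `s > 0`. -/
def sobolevSpace (d : ℕ) (s : ℝ) : Set (E d → ℝ) :=
  {f | f ∈ intSobolevSpace d ⌊s⌋₊ ∧ (Int.fract s ≠ 0 → fracSeminorm d s f < ⊤)}

open scoped Classical in
/-- The norm of `W^s_2(ℝ^d, γ)`, `s > 0`. -/
def sobolevNorm (d : ℕ) (s : ℝ) (f : E d → ℝ) : ℝ :=
  if Int.fract s = 0 then intSobolevNorm d ⌊s⌋₊ f
  else intSobolevNorm d ⌊s⌋₊ f + (fracSeminorm d s f).toReal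

/-- The normalized `d`-variate probabilists' Hermite polynomial
`H_k(x) = ∏_j He_{k_j}(x_j) / √(k_j!)`. -/
def hermiteFun {d : ℕ} (k : Fin d → ℕ) (x : E d) : ℝ :=
  ∏ j, Polynomial.aeval (x j) (Polynomial.hermite (k j)) / Real.sqrt ((k j)! : ℝ)

/-- The Hermite coefficient `∫ f H_k dγ`. -/
def hermiteCoeff {d : ℕ} (f : E d → ℝ) (k : Fin d → ℕ) : ℝ :=
  ∫ x, f x * hermiteFun k x ∂(gauss d)

/-- The space `H^s(ℝ^d, γ)`: functions of `L_2(γ)` that are the `L_2(γ)`-sum of their Hermite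
series and have a finite `H^s`-norm. -/
def hermiteSpace (d : ℕ) (s : ℝ) : Set (E d → ℝ) :=
  {f | MemLp f 2 (gauss d) ∧
    Tendsto (fun F : Finset (Fin d → ℕ) =>
      eLpNorm (fun x => f x - ∑ k ∈ F, hermiteCoeff f k * hermiteFun k x) 2 (gauss d))
      atTop (𝓝 0) ∧
    Summable fun k : Fin d → ℕ => (1 + (multiAbs k : ℝ)) ^ s * |hermiteCoeff f k| ^ 2}

/-- The norm `(∑_k (1 + |k|₁)^s |f̂(k)|²)^(1/2)` of `H^s(ℝ^d, γ)`. -/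
def hermiteNorm (d : ℕ) (s : ℝ) (f : E d → ℝ) : ℝ :=
  Real.sqrt (∑' k : Fin d → ℕ, (1 + (multiAbs k : ℝ)) ^ s * |hermiteCoeff f k| ^ 2)

end GaussianSobolev

end

noncomputable section

namespace GaussianSobolev

section

open ProbabilityTheory

/-! ### The standard Gaussian measure -/

/-! In the orthonormal Hermite basis of `L_2(γ)` all quantities become weighted `ℓ_2` sums of the
coefficients `f̂(m)`, so the theorem reduces to a comparison of weights.

Derivatives: integration by parts against `γ` turns `D_i` into an index shift, so `D^α f` has `k`-th
coefficient `√((k+α)!/k!) f̂(k+α)` (`hermiteCoeff_of_isWeakDeriv`), and `‖D^α f‖²` is the sum of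
`m!/(m-α)! · f̂(m)²`. Conversely, if these sums converge, the shifted coefficients define an
`L_2(γ)` function which is the weak derivative (`exists_isWeakDeriv_of_summable`).

Seminorm: `M_t(x, y) dγ(y)` is the Ornstein–Uhlenbeck transition law, and its operator multiplies
`H_k` by `e^{-t|k|}`. Hence the integral of `|g(x) - g(y)|² M_t(x, y)` is `2 ∑ (1 - e^{-t|k|})
ĝ(k)²`. Integrating against `t^{-σ-1} dt` and scaling in `t` yields a finite positive constant times
`∑ |k|^σ ĝ(k)²` (`lintegral_ouKernel`).

With `g = D^α f`, `|α| = n`, the weights are `(|m|-n)^σ m!/(m-α)!`. Each is at most `(1+|m|)^{n+σ}`,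
and together with the weight `1` of the `L_2` norm they dominate a multiple of it, already through
`α = n e_i` with `m_i` the largest entry of `m` (`rpow_le_sum_fallWeight`). The integer case is `σ =
0`, without kernel. -/

theorem gaussDensity_pos (d : ℕ) (x : E d) : 0 < gaussDensity d x := by
  unfold gaussDensity; positivity

theorem continuous_gaussDensity (d : ℕ) : Continuous (gaussDensity d) := by
  unfold gaussDensity; fun_prop

theorem measurable_ofReal_gaussDensity (d : ℕ) :
    Measurable fun x : E d => ENNReal.ofReal (gaussDensity d x) :=
  (continuous_gaussDensity d).measurable.ennreal_ofReal

theorem integral_gauss {F : Type*} [NormedAddCommGroup F] [NormedSpace ℝ F] (d : ℕ)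
    (f : E d → F) : ∫ x, f x ∂(gauss d) = ∫ x, gaussDensity d x • f x := by
  rw [gauss, integral_withDensity_eq_integral_toReal_smul (measurable_ofReal_gaussDensity d)
    (ae_of_all _ fun _ => ENNReal.ofReal_lt_top)]
  simp only [ENNReal.toReal_ofReal (gaussDensity_pos d _).le]

theorem integrable_gauss_iff {F : Type*} [NormedAddCommGroup F] [NormedSpace ℝ F] {d : ℕ}
    {f : E d → F} : Integrable f (gauss d) ↔ Integrable fun x => gaussDensity d x • f x := by
  rw [gauss, integrable_withDensity_iff_integrable_smul' (measurable_ofReal_gaussDensity d)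
    (ae_of_all _ fun _ => ENNReal.ofReal_lt_top)]
  simp only [ENNReal.toReal_ofReal (gaussDensity_pos d _).le]

theorem gauss_absolutelyContinuous (d : ℕ) : gauss d ≪ volume :=
  withDensity_absolutelyContinuous _ _

instance isFiniteMeasure_gauss (d : ℕ) : IsFiniteMeasure (gauss d) := by
  refine isFiniteMeasure_withDensity_ofReal (Integrable.hasFiniteIntegral ?_)
  unfold gaussDensity
  refine Integrable.const_mul ?_ _
  have h := (GaussianFourier.integrable_cexp_neg_mul_sq_norm_add (V := E d) (b := 1 / 2)
    (by norm_num) 0 0).norm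
  refine h.congr (ae_of_all _ fun x => ?_)
  simp only [Complex.norm_exp]
  congr 1
  simp only [zero_mul, add_zero, ← Complex.ofReal_pow, neg_mul, Complex.neg_re]
  rw [show (1 / 2 : ℂ) = ((1 / 2 : ℝ) : ℂ) by push_cast; rfl, ← Complex.ofReal_mul,
    Complex.ofReal_re]
  ring

/-- Both measures have characteristic function `exp(-|t|²/2)`. The identification supplies the
product structure of `γ`, which reduces Hermite and Mehler integrals to one variable. -/
theorem gauss_eq_stdGaussian (d : ℕ) : gauss d = stdGaussian (E d) := by
  refine Measure.ext_of_charFun ?_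
  ext t
  rw [charFun_stdGaussian, charFun_apply, integral_gauss]
  have h := GaussianFourier.integral_cexp_neg_mul_sq_norm_add (V := E d) (b := 1 / 2)
    (by norm_num) Complex.I t
  have h2 : (fun x : E d => gaussDensity d x • Complex.exp ((inner ℝ x t : ℝ) * Complex.I)) =
      fun x : E d => (((2 * Real.pi) ^ (-(d : ℝ) / 2) : ℝ) : ℂ) *
        Complex.exp (-(1 / 2) * ‖x‖ ^ 2 + Complex.I * (inner ℝ t x : ℝ)) := by
    ext x
    rw [gaussDensity, Complex.real_smul, Complex.exp_add, real_inner_comm]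
    push_cast
    rw [show (-(1 / 2) * (‖x‖ : ℂ) ^ 2) = -(‖x‖ : ℂ) ^ 2 / 2 by ring,
      mul_comm Complex.I]
    ring
  rw [h2, integral_const_mul, h]
  rw [finrank_euclideanSpace_fin]
  have h3 : ((Real.pi : ℂ) / (1 / 2)) = ((2 * Real.pi : ℝ) : ℂ) := by push_cast; ring
  rw [h3, show ((d : ℂ) / 2) = (((d : ℝ) / 2 : ℝ) : ℂ) by push_cast; rfl,
    ← Complex.ofReal_cpow (by positivity), ← mul_assoc, ← Complex.ofReal_mul,
    ← Real.rpow_add (by positivity)]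
  simp only [Complex.I_sq]
  rw [show -(d : ℝ) / 2 + d / 2 = 0 by ring, Real.rpow_zero]
  push_cast
  rw [one_mul]
  congr 1
  ring

theorem gauss_eq_map_pi (d : ℕ) :
    gauss d = (Measure.pi fun _ : Fin d => gaussianReal 0 1).map (WithLp.toLp 2) := by
  rw [gauss_eq_stdGaussian, ← map_pi_eq_stdGaussian]

instance isProbabilityMeasure_gauss (d : ℕ) : IsProbabilityMeasure (gauss d) := by
  rw [gauss_eq_stdGaussian]; infer_instance

theorem measurePreserving_toLp_gauss (d : ℕ) :
    MeasurePreserving (MeasurableEquiv.toLp 2 (Fin d → ℝ))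
      (Measure.pi fun _ : Fin d => gaussianReal 0 1) (gauss d) :=
  ⟨(MeasurableEquiv.toLp 2 (Fin d → ℝ)).measurable, (gauss_eq_map_pi d).symm⟩

theorem integral_gauss_prod {d : ℕ} (f : Fin d → ℝ → ℝ) :
    ∫ x : E d, ∏ i, f i (x i) ∂(gauss d) = ∏ i, ∫ y, f i y ∂(gaussianReal 0 1) := by
  rw [← (measurePreserving_toLp_gauss d).integral_comp (MeasurableEquiv.measurableEmbedding _)]
  exact integral_fintype_prod_eq_prod f

theorem integrable_gauss_prod {d : ℕ} {f : Fin d → ℝ → ℝ}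
    (hf : ∀ i, Integrable (f i) (gaussianReal 0 1)) :
    Integrable (fun x : E d => ∏ i, f i (x i)) (gauss d) := by
  rw [← (measurePreserving_toLp_gauss d).integrable_comp_emb
    (MeasurableEquiv.measurableEmbedding _)]
  exact Integrable.fintype_prod hf

/-! ### Polynomials and one-dimensional Gaussian measures -/

open Polynomial NNReal

theorem integrable_eval_gaussianReal (m : ℝ) (v : ℝ≥0) (p : ℝ[X]) :
    Integrable (fun x => p.eval x) (gaussianReal m v) := by
  induction p using Polynomial.induction_on' with
  | add p q hp hq => simpa only [eval_add] using! hp.add hq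
  | monomial n a =>
    simp only [eval_monomial]
    refine Integrable.const_mul ?_ a
    exact integrable_pow_of_mem_interior_integrableExpSet (X := fun x => x)
      (by simp [integrableExpSet_fun_id_gaussianReal]) n

theorem hasDerivAt_gaussianPDFReal (m : ℝ) (v : ℝ≥0) (x : ℝ) :
    HasDerivAt (gaussianPDFReal m v) (-((x - m) / v) * gaussianPDFReal m v x) x := by
  by_cases hv : v = 0
  · subst hv; simp
  have hv' : (v : ℝ) ≠ 0 := by exact_mod_cast hv
  simp only [gaussianPDFReal_def]
  have h : HasDerivAt (fun x : ℝ => -(x - m) ^ 2 / (2 * v)) (-((x - m) / v)) x := by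
    have := ((((hasDerivAt_id x).sub_const m).pow 2).neg).div_const (2 * (v : ℝ))
    refine this.congr_deriv ?_
    simp
    field_simp
  refine (h.exp.const_mul _).congr_deriv ?_
  ring

/-- Gaussian integration by parts for polynomials. -/
theorem integral_X_mul_gaussianReal (m : ℝ) {v : ℝ≥0} (hv : v ≠ 0) (p : ℝ[X]) :
    ∫ x, (X * p).eval x ∂(gaussianReal m v) =
      m * ∫ x, p.eval x ∂(gaussianReal m v) +
        v * ∫ x, (derivative p).eval x ∂(gaussianReal m v) := by
  have hv' : (v : ℝ) ≠ 0 := by exact_mod_cast hv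
  have hint : ∀ q : ℝ[X], Integrable fun x => gaussianPDFReal m v x * q.eval x := by
    intro q
    have := integrable_eval_gaussianReal m v q
    rw [gaussianReal_of_var_ne_zero _ hv, integrable_withDensity_iff_integrable_smul'
      (measurable_gaussianPDF _ _) (ae_of_all _ fun _ => gaussianPDF_lt_top)] at this
    simpa [toReal_gaussianPDF] using this
  have key := integral_mul_deriv_eq_deriv_mul_of_integrable
    (u := fun x => p.eval x) (v := gaussianPDFReal m v) (u' := fun x => (derivative p).eval x)
    (v' := fun x => -((x - m) / v) * gaussianPDFReal m v x)
    (fun x _ => p.hasDerivAt x) (fun x _ => hasDerivAt_gaussianPDFReal m v x) ?_ ?_ ?_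
  · simp only [integral_gaussianReal_eq_integral_smul hv, smul_eq_mul]
    have e1 : ∫ x, p.eval x * (-((x - m) / v) * gaussianPDFReal m v x) =
        -((v : ℝ)⁻¹) * (∫ x, gaussianPDFReal m v x * (X * p).eval x) +
          (v : ℝ)⁻¹ * m * ∫ x, gaussianPDFReal m v x * p.eval x := by
      rw [← integral_const_mul, ← integral_const_mul, ← integral_add]
      · congr 1; ext x; simp; ring
      · exact (hint _).const_mul _
      · exact (hint _).const_mul _
    have e2 : ∫ x, (derivative p).eval x * gaussianPDFReal m v x =
        ∫ x, gaussianPDFReal m v x * (derivative p).eval x := by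
      congr 1; ext x; ring
    rw [e1, e2] at key
    field_simp at key
    linarith
  · refine ((hint ((C (-(v : ℝ)⁻¹)) * (X - C m) * p))).congr (ae_of_all _ fun x => ?_)
    simp; ring
  · refine (hint (derivative p)).congr (ae_of_all _ fun x => ?_)
    simp; ring
  · refine (hint p).congr (ae_of_all _ fun x => ?_)
    simp; ring

/-- The real Hermite polynomials. -/
def hermiteR (n : ℕ) : ℝ[X] := (hermite n).map (Int.castRingHom ℝ)

theorem aeval_hermite_eq (n : ℕ) (x : ℝ) : aeval x (hermite n) = (hermiteR n).eval x := by
  rw [hermiteR, eval_map, aeval_def]; rfl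

theorem hermiteR_zero : hermiteR 0 = 1 := by simp [hermiteR]

theorem hermiteR_succ (n : ℕ) :
    hermiteR (n + 1) = X * hermiteR n - derivative (hermiteR n) := by
  simp [hermiteR, hermite_succ, derivative_map]

/-- Differentiating the recursion gives `h_{n+1} + X h_{n+1}' - h_{n+1}''`; by induction the last
two terms are `(n+1)(X h_n - h_n') = (n+1) h_{n+1}`. -/
theorem derivative_hermiteR_succ (n : ℕ) :
    derivative (hermiteR (n + 1)) = C ((n : ℝ) + 1) * hermiteR n := by
  induction n with
  | zero => simp [hermiteR_succ, hermiteR_zero]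
  | succ n ih =>
    rw [hermiteR_succ (n + 1), derivative_sub, derivative_mul, ih]
    rw [derivative_mul, derivative_C, hermiteR_succ n]
    simp
    ring

/-- At `n = 0` the truncated index `n - 1` is harmless because its coefficient vanishes; lowered
Hermite indices below rely on the same convention. -/
theorem derivative_hermiteR (n : ℕ) :
    derivative (hermiteR n) = C (n : ℝ) * hermiteR (n - 1) := by
  cases n with
  | zero => simp [hermiteR_zero]
  | succ n => simpa using derivative_hermiteR_succ n

/-- Mehler's eigenvalue relation. Integration by parts in the recursion produces `r x E[h_n] + (1 -
r²) E[h_n'] - E[h_n']`; the induction hypothesis makes this `r^{n+1} (x h_n(x) - h_n'(x))`. -/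
theorem integral_hermiteR_mehler {r : ℝ} (v : ℝ≥0) (hv : v ≠ 0) (hr : (v : ℝ) = 1 - r ^ 2) (x : ℝ)
    (n : ℕ) : ∫ y, (hermiteR n).eval y ∂(gaussianReal (r * x) v) =
      r ^ n * (hermiteR n).eval x := by
  induction n using Nat.strong_induction_on with
  | _ n ih =>
    cases n with
    | zero => simp [hermiteR_zero]
    | succ n =>
      have h1 : ∫ y, (hermiteR (n + 1)).eval y ∂(gaussianReal (r * x) v) =
          ∫ y, (X * hermiteR n).eval y ∂(gaussianReal (r * x) v) -
            ∫ y, (derivative (hermiteR n)).eval y ∂(gaussianReal (r * x) v) := by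
        rw [← integral_sub (integrable_eval_gaussianReal _ _ _)
          (integrable_eval_gaussianReal _ _ _)]
        simp [hermiteR_succ]
      rw [h1, integral_X_mul_gaussianReal _ hv, ih n (by omega), hr]
      have h2 : ∫ y, (derivative (hermiteR n)).eval y ∂(gaussianReal (r * x) v) =
          n * (r ^ (n - 1) * (hermiteR (n - 1)).eval x) := by
        cases n with
        | zero => simp [hermiteR_zero]
        | succ n =>
          simp only [derivative_hermiteR, eval_mul, eval_C, integral_const_mul]
          rw [ih _ (by omega)]
      rw [h2, hermiteR_succ, derivative_hermiteR]
      cases n with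
      | zero => simp; ring
      | succ n => simp; ring

theorem integral_hermiteR_mul (n m : ℕ) :
    ∫ y, (hermiteR n).eval y * (hermiteR m).eval y ∂(gaussianReal 0 1) =
      if n = m then (n ! : ℝ) else 0 := by
  -- Under the Gaussian, `q ↦ X q - q'` is adjoint to differentiation, so an index can be traded for
  -- a derivative of the other factor.
  have step : ∀ (n : ℕ) (q : ℝ[X]),
      ∫ y, (hermiteR (n + 1) * q).eval y ∂(gaussianReal 0 1) =
        ∫ y, (hermiteR n * derivative q).eval y ∂(gaussianReal 0 1) := by
    intro n q
    have h0 : hermiteR (n + 1) * q = X * (hermiteR n * q) - derivative (hermiteR n) * q := by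
      rw [hermiteR_succ]; ring
    have h1 := integral_X_mul_gaussianReal 0 one_ne_zero (hermiteR n * q)
    rw [h0]
    simp only [eval_sub]
    rw [integral_sub (integrable_eval_gaussianReal _ _ _) (integrable_eval_gaussianReal _ _ _), h1]
    simp only [zero_mul, zero_add, NNReal.coe_one, one_mul, derivative_mul, eval_add]
    rw [integral_add (integrable_eval_gaussianReal _ _ _) (integrable_eval_gaussianReal _ _ _)]
    ring
  simp only [← eval_mul]
  induction n generalizing m with
  | zero =>
    cases m with
    | zero => simp [hermiteR_zero]
    | succ m => rw [mul_comm, step]; simp [hermiteR_zero]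
  | succ n ih =>
    cases m with
    | zero => rw [step]; simp [hermiteR_zero]
    | succ m =>
      rw [step, derivative_hermiteR_succ]
      have : ∀ y, (hermiteR n * (C ((m : ℝ) + 1) * hermiteR m)).eval y =
          ((m : ℝ) + 1) * (hermiteR n * hermiteR m).eval y := fun y => by simp; ring
      simp only [this]
      rw [integral_const_mul, ih]
      by_cases h : n = m
      · subst h; simp [Nat.factorial_succ]
      · simp [h]

end

section

open ProbabilityTheory Polynomial

/-! ### Hermite functions in several variables -/

/-- The normalized one-dimensional Hermite polynomial as a function. -/
def hermiteOne (n : ℕ) (y : ℝ) : ℝ := (hermiteR n).eval y / √(n ! : ℝ)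

theorem hermiteFun_eq {d : ℕ} (k : Fin d → ℕ) (x : E d) :
    hermiteFun k x = ∏ j, hermiteOne (k j) (x j) := by
  simp only [hermiteFun, hermiteOne, aeval_hermite_eq]

theorem sqrt_factorial_succ (n : ℕ) :
    √((n + 1)! : ℝ) = √((n : ℝ) + 1) * √(n ! : ℝ) := by
  rw [Nat.factorial_succ, Nat.cast_mul, Real.sqrt_mul (by positivity)]; push_cast; rfl

theorem hasDerivAt_hermiteOne (n : ℕ) (y : ℝ) :
    HasDerivAt (hermiteOne n) (√(n : ℝ) * hermiteOne (n - 1) y) y := by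
  refine (((hermiteR n).hasDerivAt y).div_const _).congr_deriv ?_
  rw [derivative_hermiteR]
  cases n with
  | zero => simp
  | succ n =>
    simp only [hermiteOne, eval_mul, eval_C, Nat.add_sub_cancel, sqrt_factorial_succ]
    have h1 : √((n : ℝ) + 1) ≠ 0 := by positivity
    have h2 : √(n ! : ℝ) ≠ 0 := by positivity
    push_cast
    field_simp
    rw [Real.sq_sqrt (by positivity)]
    ring

/-- The recursion read as `X h_n = h_{n+1} + h_n'`, after normalization. This three-term relation
drives both the raising identity for `γ`-weighted Hermite functions and the density of polynomials.
-/
theorem mul_hermiteOne (n : ℕ) (y : ℝ) :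
    y * hermiteOne n y =
      √((n : ℝ) + 1) * hermiteOne (n + 1) y + √(n : ℝ) * hermiteOne (n - 1) y := by
  rw [← (hasDerivAt_hermiteOne n y).deriv]
  have h := ((hermiteR n).hasDerivAt y).div_const (√(n ! : ℝ))
  rw [show deriv (hermiteOne n) y = _ from h.deriv]
  simp only [hermiteOne, hermiteR_succ, sqrt_factorial_succ, eval_sub, eval_mul, eval_X]
  have h1 : √((n : ℝ) + 1) ≠ 0 := by positivity
  have h2 : √(n ! : ℝ) ≠ 0 := by positivity
  field_simp
  ring

theorem integrable_hermiteOne_mul (n m : ℕ) :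
    Integrable (fun y => hermiteOne n y * hermiteOne m y) (gaussianReal 0 1) := by
  refine (integrable_eval_gaussianReal 0 1
    (C ((√(n ! : ℝ))⁻¹ * (√(m ! : ℝ))⁻¹) * (hermiteR n * hermiteR m))).congr
    (ae_of_all _ fun y => ?_)
  simp [hermiteOne]; ring

theorem integral_hermiteOne_mul (n m : ℕ) :
    ∫ y, hermiteOne n y * hermiteOne m y ∂(gaussianReal 0 1) = if n = m then 1 else 0 := by
  have h : ∀ y, hermiteOne n y * hermiteOne m y =
      ((√(n ! : ℝ))⁻¹ * (√(m ! : ℝ))⁻¹) * ((hermiteR n).eval y * (hermiteR m).eval y) :=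
    fun y => by simp [hermiteOne]; ring
  simp only [h]
  rw [integral_const_mul, integral_hermiteR_mul]
  split_ifs with hnm
  · subst hnm
    have h2 : √(n ! : ℝ) ≠ 0 := by positivity
    field_simp
    rw [Real.sq_sqrt (by positivity)]
  · simp

theorem contDiff_hermiteFun {d : ℕ} (k : Fin d → ℕ) {n : WithTop ℕ∞} :
    ContDiff ℝ n (hermiteFun k : E d → ℝ) := by
  have : (hermiteFun k : E d → ℝ) = fun x => ∏ j, hermiteOne (k j) (x j) :=
    funext (hermiteFun_eq k)
  rw [this]
  refine contDiff_prod fun j _ => ?_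
  unfold hermiteOne
  refine ContDiff.div_const ?_ _
  have h1 : ContDiff ℝ n fun y : ℝ => (hermiteR (k j)).eval y := by
    simpa [Polynomial.aeval_def] using (hermiteR (k j)).contDiff_aeval (𝕜 := ℝ) n
  exact h1.comp (by fun_prop)

theorem integrable_hermiteFun_mul {d : ℕ} (k l : Fin d → ℕ) :
    Integrable (fun x : E d => hermiteFun k x * hermiteFun l x) (gauss d) := by
  simp only [hermiteFun_eq, ← Finset.prod_mul_distrib]
  exact integrable_gauss_prod (f := fun j y => hermiteOne (k j) y * hermiteOne (l j) y)
    fun i => integrable_hermiteOne_mul _ _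

theorem integral_hermiteFun_mul {d : ℕ} (k l : Fin d → ℕ) :
    ∫ x : E d, hermiteFun k x * hermiteFun l x ∂(gauss d) = if k = l then 1 else 0 := by
  simp only [hermiteFun_eq, ← Finset.prod_mul_distrib]
  rw [integral_gauss_prod fun j y => hermiteOne (k j) y * hermiteOne (l j) y]
  simp only [integral_hermiteOne_mul]
  rw [Finset.prod_ite_zero]
  simp [funext_iff]

theorem memLp_hermiteFun {d : ℕ} (k : Fin d → ℕ) : MemLp (hermiteFun k : E d → ℝ) 2 (gauss d) := by
  rw [memLp_two_iff_integrable_sq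
    (contDiff_hermiteFun (n := 0) k).continuous.aestronglyMeasurable]
  simpa only [sq] using integrable_hermiteFun_mul k k

theorem hermiteFun_eq_mul_prod_erase {d : ℕ} (k : Fin d → ℕ) (x : E d) (i : Fin d) :
    hermiteFun k x =
      hermiteOne (k i) (x i) * ∏ j ∈ Finset.univ.erase i, hermiteOne (k j) (x j) := by
  rw [hermiteFun_eq, Finset.mul_prod_erase Finset.univ (fun j => hermiteOne (k j) (x j))
    (Finset.mem_univ i)]

theorem hermiteFun_add_single {d : ℕ} (k : Fin d → ℕ) (x : E d) (i : Fin d) :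
    hermiteFun (k + Pi.single i 1) x =
      hermiteOne (k i + 1) (x i) * ∏ j ∈ Finset.univ.erase i, hermiteOne (k j) (x j) := by
  rw [hermiteFun_eq_mul_prod_erase _ x i]
  congr 1
  · simp
  · refine Finset.prod_congr rfl fun j hj => ?_
    simp [Finset.ne_of_mem_erase hj]

theorem hermiteFun_sub_single {d : ℕ} (k : Fin d → ℕ) (x : E d) (i : Fin d) :
    hermiteFun (k - Pi.single i 1) x =
      hermiteOne (k i - 1) (x i) * ∏ j ∈ Finset.univ.erase i, hermiteOne (k j) (x j) := by
  rw [hermiteFun_eq_mul_prod_erase _ x i]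
  congr 1
  · simp
  · refine Finset.prod_congr rfl fun j hj => ?_
    simp [Finset.ne_of_mem_erase hj]

theorem coord_mul_hermiteFun {d : ℕ} (k : Fin d → ℕ) (x : E d) (i : Fin d) :
    x i * hermiteFun k x = √((k i : ℝ) + 1) * hermiteFun (k + Pi.single i 1) x +
      √(k i : ℝ) * hermiteFun (k - Pi.single i 1) x := by
  rw [hermiteFun_add_single, hermiteFun_sub_single, hermiteFun_eq_mul_prod_erase k x i,
    ← mul_assoc, mul_hermiteOne]
  ring

theorem partialDeriv_hermiteFun {d : ℕ} (k : Fin d → ℕ) (i : Fin d) :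
    partialDeriv i (hermiteFun k : E d → ℝ) =
      fun x => √(k i : ℝ) * hermiteFun (k - Pi.single i 1) x := by
  funext x
  have hd : DifferentiableAt ℝ (hermiteFun k : E d → ℝ) x :=
    (contDiff_hermiteFun (n := 1) k).differentiable (by norm_num) x
  rw [partialDeriv, ← hd.lineDeriv_eq_fderiv, lineDeriv]
  have h : (fun t : ℝ => hermiteFun k (x + t • EuclideanSpace.single i (1 : ℝ))) =
      fun t => hermiteOne (k i) (x i + t) *
        ∏ j ∈ Finset.univ.erase i, hermiteOne (k j) (x j) := by
    funext t
    rw [hermiteFun_eq_mul_prod_erase _ _ i]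
    congr 1
    · simp
    · refine Finset.prod_congr rfl fun j hj => ?_
      simp [Finset.ne_of_mem_erase hj]
  rw [h, hermiteFun_sub_single]
  have h2 := (((hasDerivAt_hermiteOne (k i) (x i + 0)).comp_const_add (x i) 0).mul_const
    (∏ j ∈ Finset.univ.erase i, hermiteOne (k j) (x j))).deriv
  rw [h2]
  simp
  ring

theorem hasFDerivAt_gaussDensity {d : ℕ} (x : E d) :
    HasFDerivAt (gaussDensity d) (-(gaussDensity d x) • innerSL ℝ x) x := by
  have h : HasFDerivAt (fun y : E d => -‖y‖ ^ 2 / 2) (-(innerSL ℝ x)) x := by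
    have h1 := ((hasStrictFDerivAt_norm_sq x).hasFDerivAt.neg).mul_const (1 / 2 : ℝ)
    refine (h1.congr_fderiv ?_).congr_of_eventuallyEq (Eventually.of_forall fun y => ?_)
    · ext v; simp
    · simp; ring
  refine ((h.exp).const_mul ((2 * Real.pi) ^ (-(d : ℝ) / 2))).congr_fderiv ?_
  ext v; simp [gaussDensity]; ring

theorem contDiff_gaussDensity {d : ℕ} {n : WithTop ℕ∞} : ContDiff ℝ n (gaussDensity d) := by
  unfold gaussDensity
  exact contDiff_const.mul (((contDiff_norm_sq ℝ).neg.div_const 2).exp)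

theorem partialDeriv_mul {d : ℕ} {f g : E d → ℝ} {x : E d} (i : Fin d)
    (hf : DifferentiableAt ℝ f x) (hg : DifferentiableAt ℝ g x) :
    partialDeriv i (fun y => f y * g y) x = partialDeriv i f x * g x + f x * partialDeriv i g x := by
  simp only [partialDeriv]
  rw [fderiv_fun_mul hf hg]
  simp
  ring

/-- The density contributes `-x_i`, and the lowering part of `x_i H_k` cancels `∂_i H_k` exactly.
Only a raised index survives, so a weak derivative acts on coefficients as a pure shift. -/
theorem partialDeriv_gaussDensity_mul_hermiteFun {d : ℕ} (k : Fin d → ℕ) (i : Fin d) (x : E d) :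
    partialDeriv i (fun y => gaussDensity d y * hermiteFun k y) x =
      -(√((k i : ℝ) + 1) * (gaussDensity d x * hermiteFun (k + Pi.single i 1) x)) := by
  rw [partialDeriv_mul i (hasFDerivAt_gaussDensity x).differentiableAt
    ((contDiff_hermiteFun (n := 1) k).differentiable (by norm_num) x), partialDeriv_hermiteFun]
  have h1 : partialDeriv i (gaussDensity d) x = -(gaussDensity d x * x i) := by
    rw [partialDeriv, (hasFDerivAt_gaussDensity x).fderiv]
    simp [EuclideanSpace.inner_single_right]
  have h2 := coord_mul_hermiteFun k x i
  rw [h1]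
  linear_combination -(gaussDensity d x) * h2

end

section

open ProbabilityTheory

/-! ### Completeness of the Hermite functions -/

/-- By the three-term relation the span of the Hermite functions is stable under multiplication by
each coordinate, and it contains the constants. -/
theorem eval_mem_span_hermiteFun {d : ℕ} (q : MvPolynomial (Fin d) ℝ) :
    (fun x : E d => MvPolynomial.eval x.ofLp q) ∈
      Submodule.span ℝ (Set.range (hermiteFun : (Fin d → ℕ) → E d → ℝ)) := by
  induction q using MvPolynomial.induction_on with
  | C a =>
    have h : (fun x : E d => MvPolynomial.eval x.ofLp (MvPolynomial.C a)) =
        a • (hermiteFun (0 : Fin d → ℕ) : E d → ℝ) := by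
      funext x; simp [hermiteFun]
    rw [h]
    exact Submodule.smul_mem _ _ (Submodule.subset_span ⟨0, rfl⟩)
  | add p q hp hq =>
    simp only [map_add]
    exact Submodule.add_mem _ hp hq
  | mul_X p i hp =>
    simp only [map_mul, MvPolynomial.eval_X]
    suffices h : ∀ u ∈ Submodule.span ℝ (Set.range (hermiteFun : (Fin d → ℕ) → E d → ℝ)),
        (fun x : E d => u x * x i) ∈
          Submodule.span ℝ (Set.range (hermiteFun : (Fin d → ℕ) → E d → ℝ)) from h _ hp
    clear hp
    intro u hp
    induction hp using Submodule.span_induction with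
    | mem g hg =>
      obtain ⟨k, rfl⟩ := hg
      have h : (fun x : E d => hermiteFun k x * x i) =
          √((k i : ℝ) + 1) • (hermiteFun (k + Pi.single i 1) : E d → ℝ) +
            √(k i : ℝ) • hermiteFun (k - Pi.single i 1) := by
        funext x
        rw [mul_comm, coord_mul_hermiteFun]; rfl
      rw [h]
      exact Submodule.add_mem _ (Submodule.smul_mem _ _ (Submodule.subset_span ⟨_, rfl⟩))
        (Submodule.smul_mem _ _ (Submodule.subset_span ⟨_, rfl⟩))
    | zero =>
      simp only [Pi.zero_apply, zero_mul]
      exact Submodule.zero_mem (Submodule.span ℝ (Set.range hermiteFun))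
    | add g h _ _ hg hh =>
      simp only [Pi.add_apply, add_mul]
      exact Submodule.add_mem _ hg hh
    | smul a g _ hg =>
      simp only [Pi.smul_apply, smul_eq_mul, mul_assoc]
      exact Submodule.smul_mem _ a hg

theorem memLp_integral_of_mem_span {d : ℕ} {f : E d → ℝ} (hf : MemLp f 2 (gauss d))
    (h0 : ∀ k, hermiteCoeff f k = 0) {p : E d → ℝ}
    (hp : p ∈ Submodule.span ℝ (Set.range (hermiteFun : (Fin d → ℕ) → E d → ℝ))) :
    MemLp p 2 (gauss d) ∧ ∫ x, f x * p x ∂(gauss d) = 0 := by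
  induction hp using Submodule.span_induction with
  | mem g hg =>
    obtain ⟨k, rfl⟩ := hg
    exact ⟨memLp_hermiteFun k, h0 k⟩
  | zero => exact ⟨MemLp.zero, by simp⟩
  | add g h _ _ hg hh =>
    refine ⟨hg.1.add hh.1, ?_⟩
    simp only [Pi.add_apply, mul_add]
    have h1 : Integrable (fun x => f x * g x) (gauss d) := hf.integrable_mul hg.1
    have h2 : Integrable (fun x => f x * h x) (gauss d) := hf.integrable_mul hh.1
    rw [integral_add h1 h2, hg.2, hh.2, add_zero]
  | smul a g _ hg =>
    refine ⟨hg.1.const_smul a, ?_⟩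
    simp only [Pi.smul_apply, smul_eq_mul, mul_left_comm _ a]
    rw [integral_const_mul, hg.2, mul_zero]

theorem inner_pow_mem_span_hermiteFun {d : ℕ} (ξ : E d) (n : ℕ) :
    (fun x : E d => inner ℝ x ξ ^ n) ∈
      Submodule.span ℝ (Set.range (hermiteFun : (Fin d → ℕ) → E d → ℝ)) := by
  convert eval_mem_span_hermiteFun
    ((∑ i, MvPolynomial.C (ξ i) * MvPolynomial.X i : MvPolynomial (Fin d) ℝ) ^ n) using 2 with x
  simp [PiLp.inner_apply]

/-- Uses `e^{2|u|} ≤ e^{2u} + e^{-2u}`. It provides the dominating function when the exponential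
series is integrated termwise. -/
theorem memLp_exp_abs_inner {d : ℕ} (ξ : E d) :
    MemLp (fun x : E d => Real.exp |inner ℝ x ξ|) 2 (gauss d) := by
  rw [memLp_two_iff_integrable_sq (Continuous.aestronglyMeasurable (by fun_prop))]
  have key : ∀ η : E d, Integrable (fun x : E d => Real.exp (inner ℝ x η)) (gauss d) := by
    intro η
    have := integrable_gauss_prod (f := fun i y => Real.exp (η i * y))
      fun i => integrable_exp_mul_gaussianReal (η i)
    refine this.congr (ae_of_all _ fun x => ?_)
    simp only [← Real.exp_sum, PiLp.inner_apply]
    rfl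
  have h := (key ((2 : ℝ) • ξ)).add (key ((-2 : ℝ) • ξ))
  refine h.mono' (Continuous.aestronglyMeasurable (by fun_prop)) (ae_of_all _ fun x => ?_)
  simp only [Pi.add_apply, inner_smul_right]
  rw [← Real.exp_nat_mul, Real.norm_of_nonneg (Real.exp_pos _).le]
  rcases abs_cases (inner ℝ x ξ) with h | h <;> rw [h.1]
  · push_cast; linarith [Real.exp_pos (-2 * inner ℝ x ξ)]
  · push_cast
    rw [show 2 * -inner ℝ x ξ = -2 * inner ℝ x ξ by ring]
    linarith [Real.exp_pos (2 * inner ℝ x ξ)]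

/-- Expand the exponential: each power of the inner product is a polynomial, hence in the Hermite
span and orthogonal to `f`. -/
theorem integral_mul_cexp_eq_zero {d : ℕ} {f : E d → ℝ} (hf : MemLp f 2 (gauss d))
    (h0 : ∀ k, hermiteCoeff f k = 0) (ξ : E d) :
    ∫ x, f x • Complex.exp ((inner ℝ x ξ : ℝ) * Complex.I) ∂(gauss d) = 0 := by
  have hs := hasSum_integral_of_dominated_convergence (μ := gauss d)
    (F := fun (n : ℕ) (x : E d) => f x • (((inner ℝ x ξ : ℝ) * Complex.I) ^ n / (n ! : ℂ)))
    (f := fun x => f x • Complex.exp ((inner ℝ x ξ : ℝ) * Complex.I))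
    (fun n x => |f x| * (|inner ℝ x ξ| ^ n / n !)) ?_ ?_ ?_ ?_ ?_
  · refine hs.unique ?_
    convert hasSum_zero with n
    have h1 := (memLp_integral_of_mem_span hf h0 (inner_pow_mem_span_hermiteFun ξ n)).2
    have h2 : ∀ x : E d, f x • (((inner ℝ x ξ : ℝ) * Complex.I) ^ n / (n ! : ℂ)) =
        ((f x * inner ℝ x ξ ^ n : ℝ) : ℂ) * (Complex.I ^ n / (n ! : ℂ)) := by
      intro x; rw [Complex.real_smul]; push_cast; ring
    simp only [h2]
    rw [integral_mul_const, integral_complex_ofReal, h1]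
    simp
  · intro n
    exact hf.1.smul (Continuous.aestronglyMeasurable (by fun_prop))
  · intro n
    refine ae_of_all _ fun x => le_of_eq ?_
    simp
  · refine ae_of_all _ fun x => ?_
    exact (Real.summable_pow_div_factorial _).mul_left _
  · have : ∀ x : E d, ∑' n : ℕ, |f x| * (|inner ℝ x ξ| ^ n / n !) =
        |f x| * Real.exp |inner ℝ x ξ| := by
      intro x
      rw [tsum_mul_left, Real.exp_eq_exp_ℝ, NormedSpace.exp_eq_tsum_div]
    simp only [this]
    exact hf.abs.integrable_mul (memLp_exp_abs_inner ξ)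
  · refine ae_of_all _ fun x => ?_
    have := NormedSpace.expSeries_div_hasSum_exp ((inner ℝ x ξ : ℝ) * Complex.I : ℂ)
    rw [← Complex.exp_eq_exp_ℂ] at this
    exact this.const_smul (f x)

/-- The finite measures with `γ`-densities `f⁺` and `f⁻` have equal characteristic functions, since
the Fourier transform of `f dγ` vanishes. Hence they coincide, and `f⁺ = f⁻` almost everywhere
forces `f = 0`. -/
theorem ae_eq_zero_of_hermiteCoeff_eq_zero {d : ℕ} {f : E d → ℝ} (hf : MemLp f 2 (gauss d))
    (h0 : ∀ k, hermiteCoeff f k = 0) : f =ᵐ[gauss d] 0 := by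
  have hfi : Integrable f (gauss d) := hf.integrable (by norm_num)
  let P : (E d → ℝ) → Measure (E d) := fun g =>
    (gauss d).withDensity fun x => ENNReal.ofReal (g x)
  have hae : ∀ g : E d → ℝ, Integrable g (gauss d) →
      AEMeasurable (fun x => ENNReal.ofReal (g x)) (gauss d) :=
    fun g hg => hg.1.aemeasurable.ennreal_ofReal
  have hfin : ∀ g : E d → ℝ, Integrable g (gauss d) → IsFiniteMeasure (P g) :=
    fun g hg => isFiniteMeasure_withDensity_ofReal hg.2
  have hchar : ∀ g : E d → ℝ, Integrable g (gauss d) → ∀ ξ, charFun (P g) ξ =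
      ∫ x, (max (g x) 0) • Complex.exp ((inner ℝ x ξ : ℝ) * Complex.I) ∂(gauss d) := by
    intro g hg ξ
    rw [charFun_apply, integral_withDensity_eq_integral_toReal_smul₀ (hae g hg)
      (ae_of_all _ fun _ => ENNReal.ofReal_lt_top)]
    simp only [ENNReal.toReal_ofReal']
  have := hfin f hfi
  have := hfin (-f) hfi.neg
  have hi : ∀ g : E d → ℝ, Integrable g (gauss d) → ∀ ξ : E d, Integrable
      (fun x => (max (g x) 0) • Complex.exp ((inner ℝ x ξ : ℝ) * Complex.I)) (gauss d) := by
    intro g hg ξ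
    refine hg.pos_part.norm.mono' (hg.pos_part.1.smul
      (Continuous.aestronglyMeasurable (by fun_prop))) (ae_of_all _ fun x => ?_)
    rw [norm_smul, Complex.norm_exp_ofReal_mul_I, mul_one]
  have hP : P f = P (-f) := by
    refine Measure.ext_of_charFun ?_
    ext ξ
    rw [hchar f hfi, hchar (-f) hfi.neg, ← sub_eq_zero, ← integral_sub (hi f hfi ξ)
      (hi (-f) hfi.neg ξ), ← integral_mul_cexp_eq_zero hf h0 ξ]
    congr 1
    ext x
    rw [← sub_smul]
    congr 1
    rcases le_total (f x) 0 with h | h <;> simp [h]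
  have h2 := (withDensity_eq_iff (hae f hfi) (hae _ hfi.neg) ?_).1 hP
  · filter_upwards [h2] with x hx
    simp only [Pi.neg_apply] at hx
    rcases le_total (f x) 0 with h | h
    · rw [ENNReal.ofReal_of_nonpos h] at hx
      have := ENNReal.ofReal_eq_zero.1 hx.symm
      simp only [Pi.zero_apply]; linarith
    · rw [ENNReal.ofReal_of_nonpos (p := -f x) (by linarith)] at hx
      have := ENNReal.ofReal_eq_zero.1 hx
      simp only [Pi.zero_apply]; linarith
  · have h3 : ∫⁻ x, ‖f x‖ₑ ∂(gauss d) < ⊤ := hfi.2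
    exact ((lintegral_mono fun x => Real.ofReal_le_enorm (f x)).trans_lt h3).ne

end

section

/-! ### The Hermite basis of `L_2(γ)` -/

/-- The Hermite function as an element of `L_2(γ)`. -/
def hermiteLp {d : ℕ} (k : Fin d → ℕ) : Lp ℝ 2 (gauss d) := (memLp_hermiteFun k).toLp

theorem inner_toLp_toLp {α : Type*} [MeasurableSpace α] {μ : Measure α} {f g : α → ℝ}
    (hf : MemLp f 2 μ) (hg : MemLp g 2 μ) :
    inner ℝ (hf.toLp f) (hg.toLp g) = ∫ x, f x * g x ∂μ := by
  rw [L2.inner_def]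
  refine integral_congr_ae ?_
  filter_upwards [hf.coeFn_toLp, hg.coeFn_toLp] with x h1 h2
  rw [h1, h2]
  simp [mul_comm]

theorem inner_hermiteLp {d : ℕ} {f : E d → ℝ} (hf : MemLp f 2 (gauss d)) (k : Fin d → ℕ) :
    inner ℝ (hermiteLp k) (hf.toLp f) = hermiteCoeff f k := by
  rw [hermiteLp, inner_toLp_toLp, hermiteCoeff]
  simp only [mul_comm]

theorem hermiteCoeff_congr {d : ℕ} {f g : E d → ℝ} (h : f =ᵐ[gauss d] g) (k : Fin d → ℕ) :
    hermiteCoeff f k = hermiteCoeff g k :=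
  integral_congr_ae (h.mono fun x hx => by simp only [hx])

theorem orthonormal_hermiteLp (d : ℕ) :
    Orthonormal ℝ (hermiteLp : (Fin d → ℕ) → Lp ℝ 2 (gauss d)) := by
  rw [orthonormal_iff_ite]
  intro k l
  rw [hermiteLp, hermiteLp, inner_toLp_toLp, integral_hermiteFun_mul]

theorem span_hermiteLp_orthogonal (d : ℕ) :
    (Submodule.span ℝ (Set.range (hermiteLp : (Fin d → ℕ) → Lp ℝ 2 (gauss d))))ᗮ = ⊥ := by
  rw [Submodule.eq_bot_iff]
  intro f hf
  have h := ae_eq_zero_of_hermiteCoeff_eq_zero (Lp.memLp f) fun k => by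
    rw [← inner_hermiteLp (Lp.memLp f), Lp.toLp_coeFn]
    exact hf _ (Submodule.subset_span ⟨k, rfl⟩)
  exact (Lp.eq_zero_iff_ae_eq_zero).2 h

/-- The Hilbert basis of Hermite functions. -/
def hermiteBasis (d : ℕ) : HilbertBasis (Fin d → ℕ) ℝ (Lp ℝ 2 (gauss d)) :=
  HilbertBasis.mkOfOrthogonalEqBot (orthonormal_hermiteLp d) (span_hermiteLp_orthogonal d)

theorem hermiteBasis_apply {d : ℕ} (k : Fin d → ℕ) : hermiteBasis d k = hermiteLp k := by
  rw [hermiteBasis, HilbertBasis.coe_mkOfOrthogonalEqBot]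

theorem hasSum_hermiteLp {d : ℕ} {f : E d → ℝ} (hf : MemLp f 2 (gauss d)) :
    HasSum (fun k => hermiteCoeff f k • hermiteLp k) (hf.toLp f) := by
  have h := (hermiteBasis d).hasSum_repr (hf.toLp f)
  simpa only [HilbertBasis.repr_apply_apply, hermiteBasis_apply, inner_hermiteLp hf] using h

theorem hasSum_hermiteCoeff_mul {d : ℕ} {f g : E d → ℝ} (hf : MemLp f 2 (gauss d))
    (hg : MemLp g 2 (gauss d)) :
    HasSum (fun k => hermiteCoeff f k * hermiteCoeff g k) (∫ x, f x * g x ∂(gauss d)) := by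
  have h := (hermiteBasis d).hasSum_inner_mul_inner (hf.toLp f) (hg.toLp g)
  simp only [hermiteBasis_apply, real_inner_comm (hermiteLp _) (hf.toLp f),
    inner_hermiteLp, inner_toLp_toLp] at h
  exact h

theorem eLpNorm_toReal_sq {α : Type*} [MeasurableSpace α] {μ : Measure α} {f : α → ℝ}
    (hf : MemLp f 2 μ) : (eLpNorm f 2 μ).toReal ^ 2 = ∫ x, f x ^ 2 ∂μ := by
  have h := real_inner_self_eq_norm_sq (hf.toLp f)
  rw [inner_toLp_toLp, Lp.norm_toLp] at h
  rw [← h]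
  simp only [sq]

theorem hasSum_hermiteCoeff_sq {d : ℕ} {f : E d → ℝ} (hf : MemLp f 2 (gauss d)) :
    HasSum (fun k => hermiteCoeff f k ^ 2) (∫ x, f x ^ 2 ∂(gauss d)) := by
  simpa only [sq] using hasSum_hermiteCoeff_mul hf hf

theorem tendsto_eLpNorm_hermite_sum {d : ℕ} {f : E d → ℝ} (hf : MemLp f 2 (gauss d)) :
    Tendsto (fun F : Finset (Fin d → ℕ) =>
      eLpNorm (fun x => f x - ∑ k ∈ F, hermiteCoeff f k * hermiteFun k x) 2 (gauss d))
      atTop (𝓝 0) := by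
  have hm : ∀ F : Finset (Fin d → ℕ),
      MemLp (fun x => ∑ k ∈ F, hermiteCoeff f k * hermiteFun k x) 2 (gauss d) :=
    fun F => memLp_finsetSum F fun k _ => (memLp_hermiteFun k).const_mul _
  have h := (Lp.tendsto_Lp_iff_tendsto_eLpNorm'' (fi := atTop) _ hm f hf).1 ?_
  · refine h.congr fun F => ?_
    rw [← eLpNorm_neg]
    congr 1
    ext x; simp
  · have h2 := hasSum_hermiteLp hf
    refine Tendsto.congr (fun F => ?_) h2
    refine Lp.ext ?_
    have h3 : ∀ k ∈ F, (hermiteCoeff f k • hermiteLp k : Lp ℝ 2 (gauss d)) =ᵐ[gauss d]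
        fun x => hermiteCoeff f k * hermiteFun k x := by
      intro k _
      filter_upwards [Lp.coeFn_smul (hermiteCoeff f k) (hermiteLp k),
        (memLp_hermiteFun k).coeFn_toLp] with x h1 h2
      rw [h1, Pi.smul_apply, hermiteLp, h2, smul_eq_mul]
    refine (Lp.coeFn_finsetSum _ _).trans ?_
    refine EventuallyEq.trans ?_ (hm F).coeFn_toLp.symm
    have h4 : ∀ᵐ x ∂(gauss d), ∀ k ∈ F, (hermiteCoeff f k • hermiteLp k : Lp ℝ 2 (gauss d)) x =
        hermiteCoeff f k * hermiteFun k x := (ae_ball_iff F.countable_toSet).2 h3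
    filter_upwards [h4] with x hx
    rw [Finset.sum_apply]
    exact Finset.sum_congr rfl hx

theorem exists_memLp_hermiteCoeff_eq {d : ℕ} {c : (Fin d → ℕ) → ℝ}
    (hc : Summable fun k => c k ^ 2) :
    ∃ g : E d → ℝ, MemLp g 2 (gauss d) ∧ ∀ k, hermiteCoeff g k = c k := by
  have hmem : Memℓp c 2 := by
    refine memℓp_gen ?_
    simpa using hc
  let g := (hermiteBasis d).repr.symm ⟨c, hmem⟩
  refine ⟨g, Lp.memLp g, fun k => ?_⟩
  rw [← inner_hermiteLp (Lp.memLp g), Lp.toLp_coeFn, ← hermiteBasis_apply,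
    ← HilbertBasis.repr_apply_apply]
  simp [g]

end

section

open ProbabilityTheory Polynomial NNReal

/-! ### The Mehler kernel -/

/-- The one-dimensional Mehler kernel. -/
def mehlerOne (t x y : ℝ) : ℝ :=
  (√(1 - Real.exp (-2 * t)))⁻¹ *
    Real.exp (-((Real.exp (-2 * t) * x ^ 2 - 2 * Real.exp (-t) * (x * y)
      + Real.exp (-2 * t) * y ^ 2) / (2 * (1 - Real.exp (-2 * t)))))

theorem one_sub_exp_pos {t : ℝ} (ht : 0 < t) : 0 < 1 - Real.exp (-2 * t) := by
  have : Real.exp (-2 * t) < 1 := by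
    simpa using ht
  linarith

theorem mehler_eq_prod {d : ℕ} {t : ℝ} (ht : 0 < t) (x y : E d) :
    mehler t x y = ∏ j, mehlerOne t (x j) (y j) := by
  have h0 := one_sub_exp_pos ht
  simp only [mehlerOne, Finset.prod_mul_distrib, Finset.prod_const, Finset.card_univ,
    Fintype.card_fin, ← Real.exp_sum]
  rw [mehler]
  congr 1
  · rw [one_div, inv_pow, Real.sqrt_eq_rpow, ← Real.rpow_natCast, ← Real.rpow_mul h0.le]
    congr 2; ring
  · congr 1
    rw [Finset.sum_neg_distrib, ← Finset.sum_div, Finset.sum_add_distrib,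
      Finset.sum_sub_distrib, ← Finset.mul_sum, ← Finset.mul_sum, ← Finset.mul_sum,
      EuclideanSpace.real_norm_sq_eq, EuclideanSpace.real_norm_sq_eq, PiLp.inner_apply]
    simp only [RCLike.inner_apply, conj_trivial, mul_comm]

theorem mehler_comm {d : ℕ} (t : ℝ) (x y : E d) : mehler t x y = mehler t y x := by
  rw [mehler, mehler, real_inner_comm]
  congr 3
  ring

theorem mehler_pos {d : ℕ} {t : ℝ} (ht : 0 < t) (x y : E d) : 0 < mehler t x y := by
  have := one_sub_exp_pos ht
  unfold mehler; positivity

theorem measurable_mehler (d : ℕ) :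
    Measurable fun p : ℝ × E d × E d => mehler p.1 p.2.1 p.2.2 := by
  unfold mehler
  fun_prop

/-- The variance `1 - e^{-2t}`. -/
def mehlerVar (t : ℝ) : ℝ≥0 := Real.toNNReal (1 - Real.exp (-2 * t))

theorem coe_mehlerVar {t : ℝ} (ht : 0 < t) : (mehlerVar t : ℝ) = 1 - Real.exp (-t) ^ 2 := by
  rw [mehlerVar, Real.coe_toNNReal _ (one_sub_exp_pos ht).le, ← Real.exp_nat_mul]
  congr 2
  push_cast; ring

theorem mehlerVar_ne_zero {t : ℝ} (ht : 0 < t) : mehlerVar t ≠ 0 := by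
  rw [mehlerVar, ne_eq, Real.toNNReal_eq_zero, not_le]
  exact one_sub_exp_pos ht

/-- Completing the square: `M_t(x, ·) dγ` is the law `N(e^{-t} x, 1 - e^{-2t})`, to which
`integral_hermiteR_mehler` applies with `r = e^{-t}`. -/
theorem mehlerOne_mul_gaussianPDFReal {t : ℝ} (ht : 0 < t) (x y : ℝ) :
    gaussianPDFReal 0 1 y * mehlerOne t x y =
      gaussianPDFReal (Real.exp (-t) * x) (mehlerVar t) y := by
  have h0 := one_sub_exp_pos ht
  have h1 : (mehlerVar t : ℝ) = 1 - Real.exp (-2 * t) :=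
    Real.coe_toNNReal _ (one_sub_exp_pos ht).le
  have h2 : Real.exp (-2 * t) = Real.exp (-t) ^ 2 := by
    rw [← Real.exp_nat_mul]; congr 1; push_cast; ring
  simp only [gaussianPDFReal, mehlerOne, h1, NNReal.coe_one, mul_one, sub_zero]
  rw [mul_mul_mul_comm, ← Real.exp_add, ← mul_inv, ← Real.sqrt_mul (by positivity)]
  congr 2
  rw [h2] at h0 ⊢
  field_simp
  ring

theorem integral_mehlerOne_mul {t : ℝ} (ht : 0 < t) (x : ℝ) (p : ℝ[X]) :
    Integrable (fun y => mehlerOne t x y * p.eval y) (gaussianReal 0 1) ∧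
    ∫ y, mehlerOne t x y * p.eval y ∂(gaussianReal 0 1) =
      ∫ y, p.eval y ∂(gaussianReal (Real.exp (-t) * x) (mehlerVar t)) := by
  constructor
  · have := integrable_eval_gaussianReal (Real.exp (-t) * x) (mehlerVar t) p
    rw [gaussianReal_of_var_ne_zero _ (mehlerVar_ne_zero ht),
      integrable_withDensity_iff_integrable_smul' (measurable_gaussianPDF _ _)
      (ae_of_all _ fun _ => gaussianPDF_lt_top)] at this
    rw [gaussianReal_of_var_ne_zero _ one_ne_zero,
      integrable_withDensity_iff_integrable_smul' (measurable_gaussianPDF _ _)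
      (ae_of_all _ fun _ => gaussianPDF_lt_top)]
    simp only [toReal_gaussianPDF, smul_eq_mul] at this ⊢
    simpa only [← mul_assoc, mehlerOne_mul_gaussianPDFReal ht] using this
  · rw [integral_gaussianReal_eq_integral_smul one_ne_zero,
      integral_gaussianReal_eq_integral_smul (mehlerVar_ne_zero ht)]
    simp only [smul_eq_mul, ← mul_assoc, mehlerOne_mul_gaussianPDFReal ht]

theorem integral_mehler_mul_hermiteFun {d : ℕ} {t : ℝ} (ht : 0 < t) (k : Fin d → ℕ) (x : E d) :
    Integrable (fun y => mehler t x y * hermiteFun k y) (gauss d) ∧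
    ∫ y, mehler t x y * hermiteFun k y ∂(gauss d) =
      Real.exp (-t) ^ multiAbs k * hermiteFun k x := by
  have h1 : ∀ (n : ℕ) (x y : ℝ), mehlerOne t x y * hermiteOne n y =
      (mehlerOne t x y * (hermiteR n).eval y) * (√(n ! : ℝ))⁻¹ := fun n x y => by
    rw [hermiteOne]; ring
  have h2 : ∀ y : E d, mehler t x y * hermiteFun k y =
      ∏ j, (mehlerOne t (x j) (y j) * (hermiteR (k j)).eval (y j)) * (√((k j)! : ℝ))⁻¹ := by
    intro y
    rw [mehler_eq_prod ht, hermiteFun_eq, ← Finset.prod_mul_distrib]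
    simp only [h1]
  simp only [h2]
  constructor
  · exact integrable_gauss_prod
      (f := fun j y => (mehlerOne t (x j) y * (hermiteR (k j)).eval y) * (√((k j)! : ℝ))⁻¹)
      fun j => (integral_mehlerOne_mul ht (x j) _).1.mul_const _
  · rw [integral_gauss_prod
      (f := fun j y => (mehlerOne t (x j) y * (hermiteR (k j)).eval y) * (√((k j)! : ℝ))⁻¹),
      hermiteFun_eq, multiAbs, ← Finset.prod_pow_eq_pow_sum, ← Finset.prod_mul_distrib]
    refine Finset.prod_congr rfl fun j _ => ?_
    rw [integral_mul_const, (integral_mehlerOne_mul ht (x j) _).2,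
      integral_hermiteR_mehler _ (mehlerVar_ne_zero ht) (coe_mehlerVar ht), hermiteOne]
    ring

theorem lintegral_mehler {d : ℕ} {t : ℝ} (ht : 0 < t) (x : E d) :
    ∫⁻ y, ENNReal.ofReal (mehler t x y) ∂(gauss d) = 1 := by
  have h := integral_mehler_mul_hermiteFun ht (0 : Fin d → ℕ) x
  simp only [multiAbs, hermiteFun, Pi.zero_apply, Polynomial.hermite_zero, map_one,
    Nat.factorial_zero, Nat.cast_one, Real.sqrt_one, div_one, Finset.prod_const_one, mul_one,
    Finset.sum_const_zero, pow_zero] at h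
  rw [← ofReal_integral_eq_lintegral_ofReal h.1 (ae_of_all _ fun y => (mehler_pos ht x y).le),
    h.2, ENNReal.ofReal_one]

/-- The joint law of the stationary Ornstein–Uhlenbeck process at two times of distance `t`. -/
def mehlerMeasure (d : ℕ) (t : ℝ) : Measure (E d × E d) :=
  ((gauss d).prod (gauss d)).withDensity fun p => ENNReal.ofReal (mehler t p.1 p.2)

theorem measurable_ofReal_mehler (d : ℕ) (t : ℝ) :
    Measurable fun p : E d × E d => ENNReal.ofReal (mehler t p.1 p.2) :=
  ((measurable_mehler d).comp (measurable_const.prodMk measurable_id)).ennreal_ofReal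

theorem measurable_ofReal_mehler_left {d : ℕ} (t : ℝ) (x : E d) :
    Measurable fun y : E d => ENNReal.ofReal (mehler t x y) := by
  unfold mehler
  fun_prop

theorem lintegral_mehlerMeasure {d : ℕ} {t : ℝ} {g : E d × E d → ℝ≥0∞} (hg : Measurable g) :
    ∫⁻ p, g p ∂(mehlerMeasure d t) =
      ∫⁻ x, ∫⁻ y, ENNReal.ofReal (mehler t x y) * g (x, y) ∂(gauss d) ∂(gauss d) := by
  rw [mehlerMeasure, lintegral_withDensity_eq_lintegral_mul _ (measurable_ofReal_mehler d t) hg,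
    lintegral_prod _ (((measurable_ofReal_mehler d t).mul hg).aemeasurable)]
  rfl

/-- Since both marginals are `γ`, functions in `L_2(γ)` of either variable lift isometrically to
`L_2` of the joint law, where their products are integrable. -/
theorem measurePreserving_fst_mehler (d : ℕ) {t : ℝ} (ht : 0 < t) :
    MeasurePreserving Prod.fst (mehlerMeasure d t) (gauss d) := by
  refine ⟨measurable_fst, Measure.ext_of_lintegral _ fun g hg => ?_⟩
  rw [lintegral_map hg measurable_fst, lintegral_mehlerMeasure (g := fun p => g p.1)
      (hg.comp measurable_fst)]
  refine lintegral_congr fun x => ?_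
  simp only
  rw [lintegral_mul_const _ (measurable_ofReal_mehler_left t x), lintegral_mehler ht, one_mul]

theorem measurePreserving_snd_mehler (d : ℕ) {t : ℝ} (ht : 0 < t) :
    MeasurePreserving Prod.snd (mehlerMeasure d t) (gauss d) := by
  refine ⟨measurable_snd, Measure.ext_of_lintegral _ fun g hg => ?_⟩
  rw [lintegral_map hg measurable_snd, lintegral_mehlerMeasure (g := fun p => g p.2)
      (hg.comp measurable_snd),
    lintegral_lintegral_swap ((measurable_ofReal_mehler d t).mul
      (hg.comp measurable_snd)).aemeasurable]
  refine lintegral_congr fun x => ?_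
  simp only [mehler_comm t _ x]
  rw [lintegral_mul_const _ (measurable_ofReal_mehler_left t x), lintegral_mehler ht, one_mul]

theorem integral_mehlerMeasure_mul_hermiteFun {d : ℕ} {t : ℝ} (ht : 0 < t) {f : E d → ℝ}
    (hf : MemLp f 2 (gauss d)) (k : Fin d → ℕ) :
    ∫ p, f p.1 * hermiteFun k p.2 ∂(mehlerMeasure d t) =
      Real.exp (-t) ^ multiAbs k * hermiteCoeff f k := by
  have h1 : MemLp (fun p : E d × E d => f p.1) 2 (mehlerMeasure d t) :=
    hf.comp_measurePreserving (measurePreserving_fst_mehler d ht)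
  have h2 : MemLp (fun p : E d × E d => (hermiteFun k p.2 : ℝ)) 2 (mehlerMeasure d t) :=
    (memLp_hermiteFun k).comp_measurePreserving (measurePreserving_snd_mehler d ht)
  have h3 : Integrable (fun p : E d × E d => f p.1 * hermiteFun k p.2) (mehlerMeasure d t) :=
    h1.integrable_mul h2
  rw [mehlerMeasure, integrable_withDensity_iff_integrable_smul' (measurable_ofReal_mehler d t)
    (ae_of_all _ fun _ => ENNReal.ofReal_lt_top)] at h3
  rw [mehlerMeasure, integral_withDensity_eq_integral_toReal_smul (measurable_ofReal_mehler d t)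
    (ae_of_all _ fun _ => ENNReal.ofReal_lt_top), integral_prod _ h3, hermiteCoeff,
    ← integral_const_mul]
  refine integral_congr_ae (ae_of_all _ fun x => ?_)
  simp only [ENNReal.toReal_ofReal (mehler_pos ht _ _).le, smul_eq_mul]
  have h4 : ∀ y, mehler t x y * (f x * hermiteFun k y) = f x * (mehler t x y * hermiteFun k y) :=
    fun y => by ring
  simp only [h4]
  rw [integral_const_mul, (integral_mehler_mul_hermiteFun ht k x).2]
  ring

/-- The pairing `g ↦ ∫ f(x) g(y)` is a continuous functional on `L_2(γ)`, composition with the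
second marginal being an isometry. It may therefore be applied termwise to the Hermite series of
`f`. -/
theorem hasSum_mehlerMeasure_mul {d : ℕ} {t : ℝ} (ht : 0 < t) {f : E d → ℝ}
    (hf : MemLp f 2 (gauss d)) :
    HasSum (fun k => Real.exp (-t) ^ multiAbs k * hermiteCoeff f k ^ 2)
      (∫ p, f p.1 * f p.2 ∂(mehlerMeasure d t)) := by
  have hm1 := measurePreserving_fst_mehler d ht
  have hm2 := measurePreserving_snd_mehler d ht
  have h1 : MemLp (fun p : E d × E d => f p.1) 2 (mehlerMeasure d t) :=
    hf.comp_measurePreserving hm1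
  have key : ∀ {g : E d → ℝ} (hg : MemLp g 2 (gauss d)),
      inner ℝ (h1.toLp _) (Lp.compMeasurePreservingₗᵢ ℝ Prod.snd hm2 (hg.toLp g)) =
        ∫ p, f p.1 * g p.2 ∂(mehlerMeasure d t) := by
    intro g hg
    have : Lp.compMeasurePreservingₗᵢ ℝ Prod.snd hm2 (hg.toLp g) =
        (hg.comp_measurePreserving hm2).toLp _ := Lp.toLp_compMeasurePreserving hg hm2
    rw [this, inner_toLp_toLp]; rfl
  rw [← key hf]
  have h := (hasSum_hermiteLp hf).mapL ((innerSL ℝ (h1.toLp _)).comp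
    (Lp.compMeasurePreservingₗᵢ ℝ Prod.snd hm2).toContinuousLinearMap)
  refine HasSum.congr_fun h fun k => ?_
  rw [map_smul, ContinuousLinearMap.comp_apply, innerSL_apply_apply, smul_eq_mul]
  have h2 := key (memLp_hermiteFun k)
  rw [integral_mehlerMeasure_mul_hermiteFun ht hf] at h2
  erw [h2]
  ring

theorem lintegral_mehlerMeasure_sub_sq {d : ℕ} {t : ℝ} (ht : 0 < t) {f : E d → ℝ}
    (hf : MemLp f 2 (gauss d)) :
    ∫⁻ p, ENNReal.ofReal (|f p.1 - f p.2| ^ 2) ∂(mehlerMeasure d t) =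
      ∑' k, ENNReal.ofReal (2 * (1 - Real.exp (-t) ^ multiAbs k) * hermiteCoeff f k ^ 2) := by
  have hm1 := measurePreserving_fst_mehler d ht
  have hm2 := measurePreserving_snd_mehler d ht
  have h1 : MemLp (fun p : E d × E d => f p.1) 2 (mehlerMeasure d t) :=
    hf.comp_measurePreserving hm1
  have h2 : MemLp (fun p : E d × E d => f p.2) 2 (mehlerMeasure d t) :=
    hf.comp_measurePreserving hm2
  have hae : AEStronglyMeasurable (fun x => f x ^ 2) (gauss d) := hf.1.pow 2
  have i1 : ∫ p, f p.1 ^ 2 ∂(mehlerMeasure d t) = ∫ x, f x ^ 2 ∂(gauss d) := by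
    rw [← hm1.map_eq, integral_map hm1.measurable.aemeasurable (by rwa [hm1.map_eq])]
  have i2 : ∫ p, f p.2 ^ 2 ∂(mehlerMeasure d t) = ∫ x, f x ^ 2 ∂(gauss d) := by
    rw [← hm2.map_eq, integral_map hm2.measurable.aemeasurable (by rwa [hm2.map_eq])]
  have hmul : Integrable (fun p : E d × E d => f p.1 * f p.2) (mehlerMeasure d t) :=
    h1.integrable_mul h2
  have hs : HasSum (fun k => 2 * (1 - Real.exp (-t) ^ multiAbs k) * hermiteCoeff f k ^ 2)
      (∫ p, |f p.1 - f p.2| ^ 2 ∂(mehlerMeasure d t)) := by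
    have e : ∫ p, |f p.1 - f p.2| ^ 2 ∂(mehlerMeasure d t) =
        2 * ∫ x, f x ^ 2 ∂(gauss d) - 2 * ∫ p, f p.1 * f p.2 ∂(mehlerMeasure d t) := by
      have : ∀ p : E d × E d, |f p.1 - f p.2| ^ 2 =
          f p.1 ^ 2 + f p.2 ^ 2 - 2 * (f p.1 * f p.2) := fun p => by rw [sq_abs]; ring
      simp only [this]
      have h3 : Integrable (fun p : E d × E d => f p.1 ^ 2 + f p.2 ^ 2) (mehlerMeasure d t) :=
        h1.integrable_sq.add h2.integrable_sq
      rw [integral_sub h3 (hmul.const_mul 2), integral_add h1.integrable_sq h2.integrable_sq, i1, i2, integral_const_mul]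
      ring
    rw [e]
    refine HasSum.congr_fun (((hasSum_hermiteCoeff_sq hf).mul_left 2).sub
      ((hasSum_mehlerMeasure_mul ht hf).mul_left 2)) fun k => ?_
    ring
  rw [← ofReal_integral_eq_lintegral_ofReal ?_ (ae_of_all _ fun p => by positivity),
    ← hs.tsum_eq, ENNReal.ofReal_tsum_of_nonneg ?_ hs.summable]
  · intro k
    have : Real.exp (-t) ^ multiAbs k ≤ 1 :=
      pow_le_one₀ (Real.exp_pos _).le (Real.exp_le_one_iff.2 (by linarith))
    have : 0 ≤ 1 - Real.exp (-t) ^ multiAbs k := by linarith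
    positivity
  · simp only [sq_abs]
    exact (h1.sub h2).integrable_sq

end

section

/-! ### The Gagliardo-type double integral -/

/-- The integral `∫_0^∞ (1 - e^{-mt}) t^{-σ-1} dt`. -/
def fracIntegral (σ : ℝ) (m : ℕ) : ℝ≥0∞ :=
  ∫⁻ t in Set.Ioi (0 : ℝ), ENNReal.ofReal ((1 - Real.exp (-t) ^ m) / t ^ (σ + 1))

/-- Substitution `u = m t`, carried out on the whole line with an indicator. For `m = 0` both sides
vanish, because `0 ^ σ = 0` for `σ > 0`. -/
theorem fracIntegral_scale {σ : ℝ} (hσ : 0 < σ) (m : ℕ) :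
    fracIntegral σ m = ENNReal.ofReal ((m : ℝ) ^ σ) * fracIntegral σ 1 := by
  rcases Nat.eq_zero_or_pos m with rfl | hm
  · simp [fracIntegral, Real.zero_rpow hσ.ne']
  have hm' : (0 : ℝ) < m := by exact_mod_cast hm
  let G : ℝ → ℝ≥0∞ := (Set.Ioi (0 : ℝ)).indicator
    fun t => ENNReal.ofReal ((1 - Real.exp (-t)) / t ^ (σ + 1))
  have hG : Measurable G := Measurable.indicator (by fun_prop) measurableSet_Ioi
  have h1 : fracIntegral σ m = ∫⁻ t, ENNReal.ofReal ((m : ℝ) ^ (σ + 1)) * G (m * t) := by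
    rw [fracIntegral, ← lintegral_indicator measurableSet_Ioi]
    refine lintegral_congr fun t => ?_
    by_cases ht : 0 < t
    · have hmt : 0 < m * t := by positivity
      simp only [G, Set.indicator, Set.mem_Ioi, ht, hmt, if_true]
      rw [← ENNReal.ofReal_mul (by positivity), Real.mul_rpow hm'.le ht.le, ← Real.exp_nat_mul]
      congr 1
      have : (m : ℝ) ^ (σ + 1) ≠ 0 := by positivity
      have : t ^ (σ + 1) ≠ 0 := by positivity
      field_simp
    · have hmt : ¬ 0 < m * t := by
        rw [mul_pos_iff_of_pos_left hm']; exact ht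
      simp [G, Set.indicator, ht, hmt]
  have h2 : ∫⁻ t, G (m * t) = ENNReal.ofReal ((m : ℝ)⁻¹) * ∫⁻ t, G t := by
    rw [← lintegral_map hG (measurable_const_mul _), Real.map_volume_mul_left hm'.ne',
      lintegral_smul_measure, abs_of_pos (by positivity), smul_eq_mul]
  have h3 : ∫⁻ t, G t = fracIntegral σ 1 := by
    rw [fracIntegral, lintegral_indicator measurableSet_Ioi]
    simp only [pow_one]
  rw [h1, lintegral_const_mul' _ _ ENNReal.ofReal_ne_top, h2, h3, ← mul_assoc,
    ← ENNReal.ofReal_mul (by positivity), Real.rpow_add hm', Real.rpow_one]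
  congr 2
  field_simp

theorem fracIntegral_one_ne_zero (σ : ℝ) : fracIntegral σ 1 ≠ 0 := by
  rw [fracIntegral, Ne, lintegral_eq_zero_iff (by fun_prop)]
  intro h
  have h2 : ∀ᵐ t ∂(volume.restrict (Set.Ioi (0 : ℝ))), False := by
    filter_upwards [h, ae_restrict_mem measurableSet_Ioi] with t h1 ht
    have ht : 0 < t := ht
    have h3 : Real.exp (-t) < 1 := by simpa using ht
    have h4 : 0 < (1 - Real.exp (-t) ^ 1) / t ^ (σ + 1) := by
      have : 0 < 1 - Real.exp (-t) ^ 1 := by rw [pow_one]; linarith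
      positivity
    simp only [Pi.zero_apply, ENNReal.ofReal_eq_zero] at h1
    linarith
  rw [eventually_false_iff_eq_bot, ae_eq_bot, Measure.restrict_eq_zero] at h2
  simp at h2

/-- Near zero `1 - e^{-t} ≤ t` leaves `t^{-σ}`, integrable for `σ < 1`; at infinity the bound
`t^{-σ-1}` is integrable for `σ > 0`. -/
theorem fracIntegral_one_ne_top {σ : ℝ} (h0 : 0 < σ) (h1 : σ < 1) : fracIntegral σ 1 ≠ ⊤ := by
  have hI1 : IntegrableOn (fun t : ℝ => t ^ (-σ)) (Set.Ioc 0 1) :=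
    (intervalIntegrable_iff_integrableOn_Ioc_of_le zero_le_one).1
      (intervalIntegral.intervalIntegrable_rpow' (by linarith))
  have hI2 : IntegrableOn (fun t : ℝ => t ^ (-(σ + 1))) (Set.Ioi 1) :=
    integrableOn_Ioi_rpow_of_lt (by linarith) one_pos
  rw [fracIntegral, ← Set.Ioc_union_Ioi_eq_Ioi (zero_le_one' ℝ)]
  refine ((lintegral_union_le _ _ _).trans_lt (ENNReal.add_lt_top.2 ⟨?_, ?_⟩)).ne
  · refine lt_of_le_of_lt (setLIntegral_mono' measurableSet_Ioc fun t ht => ?_)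
      hI1.lintegral_lt_top
    refine ENNReal.ofReal_le_ofReal ?_
    rw [div_le_iff₀ (Real.rpow_pos_of_pos ht.1 _), ← Real.rpow_add ht.1]
    have := Real.add_one_le_exp (-t)
    rw [show -σ + (σ + 1) = 1 by ring, Real.rpow_one]
    simp; linarith
  · refine lt_of_le_of_lt (setLIntegral_mono' measurableSet_Ioi fun t ht => ?_)
      hI2.lintegral_lt_top
    have ht0 : 0 < t := lt_trans one_pos ht
    refine ENNReal.ofReal_le_ofReal ?_
    rw [Real.rpow_neg ht0.le, ← one_div]
    have := Real.exp_pos (-t)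
    gcongr
    simp [this.le]

/-- Allows passing to a measurable representative, as Tonelli's theorem is applied below to
measurable functions. -/
theorem lintegral_ouKernel_congr {d : ℕ} {σ : ℝ} {f g : E d → ℝ} (h : f =ᵐ[gauss d] g) :
    ∫⁻ x, ∫⁻ y, ENNReal.ofReal (|f x - f y| ^ 2) * ouKernel σ x y ∂(gauss d) ∂(gauss d) =
      ∫⁻ x, ∫⁻ y, ENNReal.ofReal (|g x - g y| ^ 2) * ouKernel σ x y ∂(gauss d) ∂(gauss d) := by
  refine lintegral_congr_ae ?_
  filter_upwards [h] with x hx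
  refine lintegral_congr_ae ?_
  filter_upwards [h] with y hy
  rw [hx, hy]

theorem lintegral_lintegral_mul_lintegral {X T : Type*} [MeasurableSpace X] [MeasurableSpace T]
    {μ : Measure X} {ν : Measure T} [SFinite μ] [SFinite ν] {F : X × X → ℝ≥0∞}
    {N : T × X × X → ℝ≥0∞} (hF : Measurable F) (hN : Measurable N) :
    ∫⁻ x, ∫⁻ y, F (x, y) * ∫⁻ t, N (t, x, y) ∂ν ∂μ ∂μ =
      ∫⁻ t, ∫⁻ x, ∫⁻ y, F (x, y) * N (t, x, y) ∂μ ∂μ ∂ν := by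
  have hJ : Measurable fun q : T × X × X => F q.2 * N q := (hF.comp measurable_snd).mul hN
  have e1 : ∀ x y, F (x, y) * ∫⁻ t, N (t, x, y) ∂ν = ∫⁻ t, F (x, y) * N (t, x, y) ∂ν :=
    fun x y => (lintegral_const_mul _ (hN.comp measurable_prodMk_right)).symm
  simp only [e1]
  rw [← lintegral_prod (fun p : X × X => ∫⁻ t, F p * N (t, p) ∂ν)
      hJ.lintegral_prod_left'.aemeasurable,
    lintegral_lintegral_swap (f := fun (p : X × X) (t : T) => F p * N (t, p))
      (hJ.comp measurable_swap).aemeasurable]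
  refine lintegral_congr fun t => ?_
  exact lintegral_prod (fun p : X × X => F p * N (t, p))
    (hJ.comp measurable_prodMk_left).aemeasurable

theorem lintegral_ouKernel_eq_lintegral_mehlerMeasure {d : ℕ} (σ : ℝ) {f : E d → ℝ}
    (hf : Measurable f) :
    ∫⁻ x, ∫⁻ y, ENNReal.ofReal (|f x - f y| ^ 2) * ouKernel (2 * σ) x y ∂(gauss d) ∂(gauss d) =
      ∫⁻ t in Set.Ioi (0 : ℝ), ENNReal.ofReal ((t ^ (σ + 1))⁻¹) *
        ∫⁻ p, ENNReal.ofReal (|f p.1 - f p.2| ^ 2) ∂(mehlerMeasure d t) := by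
  have hF : Measurable fun p : E d × E d => ENNReal.ofReal (|f p.1 - f p.2| ^ 2) := by
    simp only [sq_abs]
    fun_prop
  have hN : Measurable fun q : ℝ × E d × E d =>
      ENNReal.ofReal (mehler q.1 q.2.1 q.2.2 / q.1 ^ (σ + 1)) :=
    ((measurable_mehler d).div (by fun_prop)).ennreal_ofReal
  have hK : ∀ x y : E d, ouKernel (2 * σ) x y =
      ∫⁻ t in Set.Ioi (0 : ℝ), ENNReal.ofReal (mehler t x y / t ^ (σ + 1)) := by
    intro x y
    rw [ouKernel, show 2 * σ / 2 + 1 = σ + 1 by ring]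
  simp only [hK]
  refine (lintegral_lintegral_mul_lintegral (μ := gauss d)
    (ν := volume.restrict (Set.Ioi (0 : ℝ))) hF hN).trans ?_
  refine setLIntegral_congr_fun measurableSet_Ioi fun t ht => ?_
  have ht : 0 < t := ht
  simp only
  rw [lintegral_mehlerMeasure hF, ← lintegral_const_mul' _ _ ENNReal.ofReal_ne_top]
  refine lintegral_congr fun x => ?_
  rw [← lintegral_const_mul' _ _ ENNReal.ofReal_ne_top]
  refine lintegral_congr fun y => ?_
  rw [div_eq_mul_inv, ENNReal.ofReal_mul (mehler_pos ht x y).le]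
  ring

/-- After Tonelli, the integral for fixed `t` is diagonal in the Hermite coefficients, and the
`t`-integral of each term is evaluated by `fracIntegral_scale`. The identity holds in `[0, ∞]`, so
it also decides when the seminorm is finite. -/
theorem lintegral_ouKernel {d : ℕ} {σ : ℝ} (hσ : 0 < σ) {f : E d → ℝ}
    (hf : MemLp f 2 (gauss d)) :
    ∫⁻ x, ∫⁻ y, ENNReal.ofReal (|f x - f y| ^ 2) * ouKernel (2 * σ) x y ∂(gauss d) ∂(gauss d) =
      2 * fracIntegral σ 1 *
        ∑' k, ENNReal.ofReal ((multiAbs k : ℝ) ^ σ * hermiteCoeff f k ^ 2) := by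
  obtain ⟨g, hg, hfg⟩ := hf.1
  have hg2 : MemLp g 2 (gauss d) := (memLp_congr_ae hfg).1 hf
  rw [lintegral_ouKernel_congr hfg, lintegral_ouKernel_eq_lintegral_mehlerMeasure σ hg.measurable]
  simp only [hermiteCoeff_congr hfg]
  have e : ∀ t ∈ Set.Ioi (0 : ℝ), ENNReal.ofReal ((t ^ (σ + 1))⁻¹) *
        ∫⁻ p, ENNReal.ofReal (|g p.1 - g p.2| ^ 2) ∂(mehlerMeasure d t) =
      ∑' k, ENNReal.ofReal (2 * hermiteCoeff g k ^ 2) *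
        ENNReal.ofReal ((1 - Real.exp (-t) ^ multiAbs k) / t ^ (σ + 1)) := by
    intro t ht
    have ht : 0 < t := ht
    rw [lintegral_mehlerMeasure_sub_sq ht hg2, ← ENNReal.tsum_mul_left]
    refine tsum_congr fun k => ?_
    rw [← ENNReal.ofReal_mul (by positivity), ← ENNReal.ofReal_mul (by positivity)]
    congr 1
    ring
  rw [setLIntegral_congr_fun measurableSet_Ioi e, lintegral_tsum fun k => by fun_prop,
    ← ENNReal.tsum_mul_left]
  refine tsum_congr fun k => ?_
  rw [lintegral_const_mul _ (by fun_prop)]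
  change _ * fracIntegral σ (multiAbs k) = _
  rw [fracIntegral_scale hσ, ENNReal.ofReal_mul (by norm_num), ENNReal.ofReal_mul (by positivity),
    ENNReal.ofReal_ofNat]
  ring

end

section

/-! ### Weak derivatives: composition and uniqueness -/

theorem contDiff_partialDeriv {d : ℕ} {η : E d → ℝ} (hη : ContDiff ℝ ∞ η) (i : Fin d) :
    ContDiff ℝ ∞ (partialDeriv i η) :=
  (hη.fderiv_right (m := ∞) (by simp)).clm_apply contDiff_const

theorem hasCompactSupport_partialDeriv {d : ℕ} {η : E d → ℝ} (hη : HasCompactSupport η)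
    (i : Fin d) : HasCompactSupport (partialDeriv i η) :=
  hη.fderiv_apply (𝕜 := ℝ) _

theorem partialDeriv_comm {d : ℕ} {η : E d → ℝ} (hη : ContDiff ℝ ∞ η) (i j : Fin d) :
    partialDeriv i (partialDeriv j η) = partialDeriv j (partialDeriv i η) := by
  funext x
  have hd : DifferentiableAt ℝ (fderiv ℝ η) x :=
    (hη.fderiv_right (m := ∞) (by simp)).differentiable (by simp) x
  have key : ∀ i j : Fin d, partialDeriv i (partialDeriv j η) x =
      fderiv ℝ (fderiv ℝ η) x (EuclideanSpace.single i 1) (EuclideanSpace.single j 1) := by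
    intro i j
    unfold partialDeriv
    rw [fderiv_clm_apply hd (differentiableAt_const _)]
    simp
  rw [key, key]
  refine (hη.contDiffAt.isSymmSndFDerivAt ?_).eq _ _
  rw [minSmoothness_of_isRCLikeNormedField]
  exact WithTop.coe_le_coe.2 (le_top : (2 : ℕ∞) ≤ ⊤)

theorem contDiff_iterate_partialDeriv {d : ℕ} (i : Fin d) (n : ℕ) {η : E d → ℝ}
    (hη : ContDiff ℝ ∞ η) : ContDiff ℝ ∞ ((partialDeriv i)^[n] η) := by
  induction n with
  | zero => exact hη
  | succ n ih => rw [Function.iterate_succ_apply']; exact contDiff_partialDeriv ih i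

theorem iterate_partialDeriv_comm {d : ℕ} (i j : Fin d) (n : ℕ) {η : E d → ℝ}
    (hη : ContDiff ℝ ∞ η) :
    partialDeriv i ((partialDeriv j)^[n] η) = (partialDeriv j)^[n] (partialDeriv i η) := by
  induction n with
  | zero => rfl
  | succ n ih =>
    rw [Function.iterate_succ_apply', Function.iterate_succ_apply',
      partialDeriv_comm (contDiff_iterate_partialDeriv j n hη), ih]

/-- The derivative in the coordinates of a list. -/
def listDeriv {d : ℕ} (α : Fin d → ℕ) (l : List (Fin d)) (η : E d → ℝ) : E d → ℝ :=
  l.foldr (fun i ψ => (partialDeriv i)^[α i] ψ) η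

theorem contDiff_listDeriv {d : ℕ} (α : Fin d → ℕ) (l : List (Fin d)) {η : E d → ℝ}
    (hη : ContDiff ℝ ∞ η) : ContDiff ℝ ∞ (listDeriv α l η) := by
  induction l with
  | nil => exact hη
  | cons j l ih => exact contDiff_iterate_partialDeriv j _ ih

theorem partialDeriv_listDeriv {d : ℕ} (i : Fin d) (α : Fin d → ℕ) (l : List (Fin d))
    {η : E d → ℝ} (hη : ContDiff ℝ ∞ η) :
    partialDeriv i (listDeriv α l η) = listDeriv α l (partialDeriv i η) := by
  induction l with
  | nil => rfl
  | cons j l ih =>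
    change partialDeriv i ((partialDeriv j)^[α j] (listDeriv α l η)) =
      (partialDeriv j)^[α j] (listDeriv α l (partialDeriv i η))
    rw [iterate_partialDeriv_comm i j _ (contDiff_listDeriv α l hη), ih]

theorem listDeriv_congr {d : ℕ} {α β : Fin d → ℕ} {l : List (Fin d)}
    (h : ∀ j ∈ l, α j = β j) (η : E d → ℝ) : listDeriv α l η = listDeriv β l η := by
  induction l with
  | nil => rfl
  | cons j l ih =>
    change (partialDeriv j)^[α j] (listDeriv α l η) = (partialDeriv j)^[β j] (listDeriv β l η)
    rw [h j (by simp), ih fun k hk => h k (by simp [hk])]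

/-- The derivatives are folded in a fixed order of coordinates. Since partial derivatives of smooth
functions commute, the extra `∂_i` can be moved innermost; `Nodup` ensures that it occurs only once.
-/
theorem listDeriv_add_single {d : ℕ} (α : Fin d → ℕ) (i : Fin d) {l : List (Fin d)}
    (hl : l.Nodup) (hi : i ∈ l) {η : E d → ℝ} (hη : ContDiff ℝ ∞ η) :
    listDeriv (α + Pi.single i 1) l η = listDeriv α l (partialDeriv i η) := by
  induction l with
  | nil => simp at hi
  | cons j l ih =>
    rw [List.nodup_cons] at hl
    change (partialDeriv j)^[(α + Pi.single i 1 : Fin d → ℕ) j] (listDeriv (α + Pi.single i 1) l η) =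
      (partialDeriv j)^[α j] (listDeriv α l (partialDeriv i η))
    by_cases hj : j = i
    · subst hj
      rw [listDeriv_congr (β := α) (fun k hk => ?_), ← partialDeriv_listDeriv _ _ _ hη]
      · simp [Function.iterate_succ_apply]
      · have : k ≠ j := fun h => hl.1 (h ▸ hk)
        simp [this]
    · have hi' : i ∈ l := by
        rcases List.mem_cons.1 hi with h | h
        · exact absurd h.symm hj
        · exact h
      rw [ih hl.2 hi']
      simp [hj]

theorem multiDeriv_add_single {d : ℕ} (α : Fin d → ℕ) (i : Fin d) {η : E d → ℝ}
    (hη : ContDiff ℝ ∞ η) :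
    multiDeriv (α + Pi.single i 1) η = multiDeriv α (partialDeriv i η) :=
  listDeriv_add_single α i (List.nodup_finRange d) (List.mem_finRange i) hη

theorem multiDeriv_zero {d : ℕ} (η : E d → ℝ) : multiDeriv 0 η = η := by
  unfold multiDeriv
  induction List.finRange d with
  | nil => rfl
  | cons j l ih => exact ih

theorem multiDeriv_single {d : ℕ} (i : Fin d) {η : E d → ℝ} (hη : ContDiff ℝ ∞ η) :
    multiDeriv (Pi.single i 1) η = partialDeriv i η := by
  rw [← zero_add (Pi.single i 1 : Fin d → ℕ), multiDeriv_add_single _ _ hη, multiDeriv_zero]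

theorem multiAbs_add {d : ℕ} (α β : Fin d → ℕ) : multiAbs (α + β) = multiAbs α + multiAbs β :=
  Finset.sum_add_distrib

theorem multiAbs_single {d : ℕ} (i : Fin d) : multiAbs (Pi.single i 1 : Fin d → ℕ) = 1 := by
  simp [multiAbs]

theorem exists_eq_add_single {d n : ℕ} {α : Fin d → ℕ} (h : multiAbs α = n + 1) :
    ∃ (β : Fin d → ℕ) (i : Fin d), α = β + Pi.single i 1 ∧ multiAbs β = n := by
  have : ∃ i, α i ≠ 0 := by
    by_contra! h0
    simp [multiAbs, h0] at h
  obtain ⟨i, hi⟩ := this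
  have e : α = (α - Pi.single i 1) + Pi.single i 1 := by
    funext j
    by_cases hj : j = i
    · subst hj; simp; omega
    · simp [hj]
  refine ⟨α - Pi.single i 1, i, e, ?_⟩
  have h2 := congrArg multiAbs e
  rw [multiAbs_add, multiAbs_single] at h2
  omega

/-- If `η` is a test function, so is `∂_i η`; inserting it into the definition of `D^α f` reduces
higher orders to first-order derivatives. -/
theorem IsWeakDeriv.add_single_iff {d : ℕ} {α : Fin d → ℕ} {i : Fin d} {f g h : E d → ℝ}
    (hg : IsWeakDeriv α f g) :
    IsWeakDeriv (α + Pi.single i 1) f h ↔ IsWeakDeriv (Pi.single i 1) g h := by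
  have key : ∀ η : E d → ℝ, ContDiff ℝ ∞ η → HasCompactSupport η →
      ∫ x, f x * multiDeriv (α + Pi.single i 1) η x =
        (-1) ^ multiAbs α * ∫ x, g x * multiDeriv (Pi.single i 1) η x := by
    intro η h1 h2
    rw [multiDeriv_add_single α i h1, multiDeriv_single i h1]
    exact hg.2.2 _ (contDiff_partialDeriv h1 i) (hasCompactSupport_partialDeriv h2 i)
  have hne : ((-1 : ℝ)) ^ multiAbs α ≠ 0 := pow_ne_zero _ (by norm_num)
  constructor
  · rintro ⟨-, h1, h2⟩
    refine ⟨hg.2.1, h1, fun η hη hc => mul_left_cancel₀ hne ?_⟩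
    rw [← key η hη hc, h2 η hη hc, multiAbs_add, pow_add, mul_assoc]
  · rintro ⟨-, h1, h2⟩
    refine ⟨hg.1, h1, fun η hη hc => ?_⟩
    rw [key η hη hc, h2 η hη hc, multiAbs_add, pow_add, mul_assoc]

theorem IsWeakDeriv.ae_eq {d : ℕ} {α : Fin d → ℕ} {f g h : E d → ℝ}
    (hg : IsWeakDeriv α f g) (hh : IsWeakDeriv α f h) : g =ᵐ[volume] h := by
  refine ae_eq_of_integral_contDiff_smul_eq hg.2.1 hh.2.1 fun η hη hc => ?_
  have hne : ((-1 : ℝ)) ^ multiAbs α ≠ 0 := pow_ne_zero _ (by norm_num)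
  have := mul_left_cancel₀ hne ((hg.2.2 η hη hc).symm.trans (hh.2.2 η hη hc))
  simpa only [smul_eq_mul, mul_comm] using this

/-- `f` times the density is Lebesgue integrable, and the reciprocal of the density is continuous,
hence locally bounded. -/
theorem locallyIntegrable_of_memLp_gauss {d : ℕ} {f : E d → ℝ} (hf : MemLp f 2 (gauss d)) :
    LocallyIntegrable f := by
  have h1 : Integrable fun x => gaussDensity d x • f x :=
    integrable_gauss_iff.1 (hf.integrable (by norm_num))
  have h2 : Continuous fun x : E d => (gaussDensity d x)⁻¹ :=
    (continuous_gaussDensity d).inv₀ fun x => (gaussDensity_pos d x).ne'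
  have h3 := (locallyIntegrableOn_univ.2 h1.locallyIntegrable).continuousOn_mul
    (g := fun x => (gaussDensity d x)⁻¹) h2.continuousOn (isClosed_univ.isLocallyClosed)
  rw [← locallyIntegrableOn_univ]
  refine h3.congr (ae_of_all _ fun x => ?_)
  simp [(gaussDensity_pos d x).ne']

theorem isWeakDeriv_zero_self {d : ℕ} {f : E d → ℝ} (hf : MemLp f 2 (gauss d)) :
    IsWeakDeriv 0 f f :=
  ⟨locallyIntegrable_of_memLp_gauss hf, locallyIntegrable_of_memLp_gauss hf, fun η _ _ => by
    simp [multiDeriv_zero, multiAbs]⟩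

theorem isWeakDeriv_weakDeriv {d : ℕ} {α : Fin d → ℕ} {f : E d → ℝ}
    (h : ∃ g, IsWeakDeriv α f g) : IsWeakDeriv α f (weakDeriv α f) := by
  rw [weakDeriv, dif_pos h]
  exact h.choose_spec

theorem IsWeakDeriv.weakDeriv_ae_eq {d : ℕ} {α : Fin d → ℕ} {f g : E d → ℝ}
    (hg : IsWeakDeriv α f g) : weakDeriv α f =ᵐ[gauss d] g :=
  (gauss_absolutelyContinuous d).ae_eq ((isWeakDeriv_weakDeriv ⟨g, hg⟩).ae_eq hg)

end

section

/-! ### Weak partial derivatives and Hermite coefficients -/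

theorem tendsto_integral_mul_cutoff {d : ℕ} {f : E d → ℝ} (hf : Integrable f (gauss d))
    {u : ℕ → E d → ℝ} (hu : ∀ n, Continuous (u n)) {C b : ℝ} (hC : ∀ n x, |u n x| ≤ C)
    (hb : ∀ x, Tendsto (fun n => u n x) atTop (𝓝 b)) :
    Tendsto (fun n => ∫ x, u n x * f x ∂(gauss d)) atTop (𝓝 (b * ∫ x, f x ∂(gauss d))) := by
  rw [← integral_const_mul]
  refine tendsto_integral_of_dominated_convergence (fun x => C * |f x|)
    (fun n => (hu n).aestronglyMeasurable.mul hf.1) (hf.abs.const_mul C)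
    (fun n => ae_of_all _ fun x => ?_) (ae_of_all _ fun x => (hb x).mul_const _)
  rw [norm_mul, Real.norm_eq_abs, Real.norm_eq_abs]
  gcongr
  exact hC n x

/-- The natural test function, density times `H_k`, lacks compact support. It is multiplied by
dilated cutoffs whose gradients tend to zero, and the limit is taken by dominated convergence. -/
theorem hermiteCoeff_of_isWeakDeriv_single {d : ℕ} {i : Fin d} {f g : E d → ℝ}
    (hf : MemLp f 2 (gauss d)) (hg : MemLp g 2 (gauss d))
    (h : IsWeakDeriv (Pi.single i 1) f g) (k : Fin d → ℕ) :
    hermiteCoeff g k = √((k i : ℝ) + 1) * hermiteCoeff f (k + Pi.single i 1) := by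
  -- A bump equal to `1` on the unit ball, dilated by `n + 1` below: its value at any fixed point
  -- tends to `1`, and its derivative gains the factor `ρ n = 1 / (n + 1)`.
  let χ : ContDiffBump (0 : E d) := ⟨1, 2, one_pos, one_lt_two⟩
  have hχ : ContDiff ℝ ∞ (χ : E d → ℝ) := χ.contDiff
  let ρ : ℕ → ℝ := fun n => ((n : ℝ) + 1)⁻¹
  have hρ0 : ∀ n, ρ n ≠ 0 := fun n => by positivity
  have hρ1 : ∀ n, |ρ n| ≤ 1 := fun n => by
    rw [abs_of_pos (by positivity)]
    exact inv_le_one_of_one_le₀ (by simp)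
  have hρ : Tendsto ρ atTop (𝓝 0) := by
    simpa only [one_div] using tendsto_one_div_add_atTop_nhds_zero_nat (𝕜 := ℝ)
  let u : ℕ → E d → ℝ := fun n x => χ (ρ n • x)
  have huc : ∀ n, ContDiff ℝ ∞ (u n) := fun n => hχ.comp (contDiff_const_smul _)
  have hupd : ∀ n x, partialDeriv i (u n) x = ρ n * partialDeriv i χ (ρ n • x) := by
    intro n x
    simp only [partialDeriv, u]
    rw [fderiv_comp_smul]
    simp
  have hcs : HasCompactSupport (partialDeriv i (χ : E d → ℝ)) :=
    hasCompactSupport_partialDeriv χ.hasCompactSupport i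
  have hpc : Continuous (partialDeriv i (χ : E d → ℝ)) := (contDiff_partialDeriv hχ i).continuous
  obtain ⟨C, hC⟩ := hcs.exists_bound_of_continuous hpc
  have hC0 : 0 ≤ C := (norm_nonneg _).trans (hC 0)
  have hubound : ∀ n x, |u n x| ≤ 1 := fun n x => by
    rw [abs_of_nonneg χ.nonneg]; exact χ.le_one
  have hulim : ∀ x, Tendsto (fun n => u n x) atTop (𝓝 1) := by
    intro x
    have h1 : Tendsto (fun n => ρ n • x) atTop (𝓝 (0 : E d)) := by
      simpa using hρ.smul_const x
    have h2 := (hχ.continuous.tendsto (0 : E d)).comp h1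
    rwa [χ.one_of_mem_closedBall (by simp [χ.rIn_pos.le])] at h2
  have hpbound : ∀ n x, |partialDeriv i (u n) x| ≤ C := fun n x => by
    rw [hupd, abs_mul]
    calc |ρ n| * |partialDeriv i χ (ρ n • x)| ≤ 1 * C :=
          mul_le_mul (hρ1 n) (hC _) (abs_nonneg _) zero_le_one
      _ = C := one_mul C
  have hplim : ∀ x, Tendsto (fun n => partialDeriv i (u n) x) atTop (𝓝 0) := by
    intro x
    refine squeeze_zero_norm (a := fun n => |ρ n| * C) (fun n => ?_) ?_
    · rw [hupd, norm_mul, Real.norm_eq_abs]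
      exact mul_le_mul_of_nonneg_left (hC _) (abs_nonneg _)
    · simpa using hρ.abs.mul_const C
  have hfk : ∀ k, Integrable (fun x => f x * hermiteFun k x) (gauss d) :=
    fun k => hf.integrable_mul (memLp_hermiteFun k)
  have hgk : Integrable (fun x => g x * hermiteFun k x) (gauss d) :=
    hg.integrable_mul (memLp_hermiteFun k)
  have hψ : ContDiff ℝ ∞ fun x : E d => gaussDensity d x * hermiteFun k x :=
    contDiff_gaussDensity.mul (contDiff_hermiteFun k)
  have key : ∀ n, ∫ x, u n x * (g x * hermiteFun k x) ∂(gauss d) =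
      √((k i : ℝ) + 1) * (∫ x, u n x * (f x * hermiteFun (k + Pi.single i 1) x) ∂(gauss d)) -
        ∫ x, partialDeriv i (u n) x * (f x * hermiteFun k x) ∂(gauss d) := by
    intro n
    have hη : ContDiff ℝ ∞ fun x => u n x * (gaussDensity d x * hermiteFun k x) :=
      (huc n).mul hψ
    have hηc : HasCompactSupport fun x => u n x * (gaussDensity d x * hermiteFun k x) :=
      (χ.hasCompactSupport.comp_smul (hρ0 n)).mul_right
    have h1 := h.2.2 _ hη hηc
    rw [multiDeriv_single i hη, multiAbs_single, pow_one] at h1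
    have e1 : ∫ x, g x * (u n x * (gaussDensity d x * hermiteFun k x)) =
        ∫ x, u n x * (g x * hermiteFun k x) ∂(gauss d) := by
      rw [integral_gauss]
      refine integral_congr_ae (ae_of_all _ fun x => ?_)
      simp only [smul_eq_mul]; ring
    have i1 : Integrable (fun x => partialDeriv i (u n) x * (f x * hermiteFun k x)) (gauss d) :=
      (hfk k).bdd_mul (c := C) (contDiff_partialDeriv (huc n) i).continuous.aestronglyMeasurable
        (ae_of_all _ (hpbound n))
    have i2 : Integrable (fun x => u n x * (f x * hermiteFun (k + Pi.single i 1) x)) (gauss d) :=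
      (hfk _).bdd_mul (c := 1) (huc n).continuous.aestronglyMeasurable
        (ae_of_all _ (hubound n))
    have e2 : ∫ x, f x * partialDeriv i
          (fun x => u n x * (gaussDensity d x * hermiteFun k x)) x =
        (∫ x, partialDeriv i (u n) x * (f x * hermiteFun k x) ∂(gauss d)) -
        √((k i : ℝ) + 1) *
          ∫ x, u n x * (f x * hermiteFun (k + Pi.single i 1) x) ∂(gauss d) := by
      rw [← integral_const_mul, ← integral_sub i1 (i2.const_mul _), integral_gauss]
      refine integral_congr_ae (ae_of_all _ fun x => ?_)
      simp only [smul_eq_mul]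
      rw [partialDeriv_mul i ((huc n).differentiable (by simp) x) (hψ.differentiable (by simp) x),
        partialDeriv_gaussDensity_mul_hermiteFun]
      ring
    rw [e1, e2] at h1
    linarith
  have l1 := tendsto_integral_mul_cutoff hgk (fun n => (huc n).continuous) hubound hulim
  have l2 := tendsto_integral_mul_cutoff (hfk (k + Pi.single i 1))
    (fun n => (huc n).continuous) hubound hulim
  have l3 := tendsto_integral_mul_cutoff (hfk k)
    (fun n => (contDiff_partialDeriv (huc n) i).continuous) hpbound hplim
  simp only [key] at l1
  have := tendsto_nhds_unique l1 ((l2.const_mul _).sub l3)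
  simpa [hermiteCoeff] using this

/-- Dividing a test function by the density turns Lebesgue pairings into inner products of `L_2(γ)`,
where Parseval is available. -/
theorem memLp_div_gaussDensity {d : ℕ} {η : E d → ℝ} (hη : Continuous η)
    (hc : HasCompactSupport η) : MemLp (fun x => η x / gaussDensity d x) 2 (gauss d) := by
  have h1 : Continuous fun x => η x / gaussDensity d x :=
    hη.div (continuous_gaussDensity d) fun x => (gaussDensity_pos d x).ne'
  have h2 : HasCompactSupport fun x => η x / gaussDensity d x := by
    simp only [div_eq_mul_inv]
    exact hc.mul_right
  exact h1.memLp_of_hasCompactSupport h2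

theorem integral_mul_eq_integral_gauss {d : ℕ} (f η : E d → ℝ) :
    ∫ x, f x * η x = ∫ x, f x * (η x / gaussDensity d x) ∂(gauss d) := by
  rw [integral_gauss]
  refine integral_congr_ae (ae_of_all _ fun x => ?_)
  have := (gaussDensity_pos d x).ne'
  simp only [smul_eq_mul]
  field_simp

theorem hermiteCoeff_partialDeriv_div {d : ℕ} (i : Fin d) {η : E d → ℝ} (hη : ContDiff ℝ ∞ η)
    (hc : HasCompactSupport η) (m : Fin d → ℕ) :
    hermiteCoeff (fun x => partialDeriv i η x / gaussDensity d x) m =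
      -(√(m i : ℝ) * hermiteCoeff (fun x => η x / gaussDensity d x) (m - Pi.single i 1)) := by
  have e : ∀ (ζ : E d → ℝ) (m : Fin d → ℕ),
      hermiteCoeff (fun x => ζ x / gaussDensity d x) m = ∫ x, hermiteFun m x * ζ x := by
    intro ζ m
    rw [integral_mul_eq_integral_gauss, hermiteCoeff]
    simp only [mul_comm]
  rw [e, e]
  have hH : ContDiff ℝ ∞ (hermiteFun m : E d → ℝ) := contDiff_hermiteFun m
  have hpH := partialDeriv_hermiteFun m i
  have hcont : ∀ {a b : E d → ℝ}, Continuous a → Continuous b → HasCompactSupport b →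
      Integrable fun x => a x * b x := fun ha hb hb' =>
    (ha.mul hb).integrable_of_hasCompactSupport hb'.mul_left
  have h := integral_mul_fderiv_eq_neg_fderiv_mul_of_integrable (μ := (volume : Measure (E d)))
    (f := hermiteFun m) (g := η) (v := EuclideanSpace.single i 1)
    (hcont (contDiff_partialDeriv hH i).continuous hη.continuous hc)
    (hcont hH.continuous (contDiff_partialDeriv hη i).continuous
      (hasCompactSupport_partialDeriv hc i))
    (hcont hH.continuous hη.continuous hc)
    (fun x _ => hH.differentiable (by simp) x) (fun x _ => hη.differentiable (by simp) x)
  change ∫ x, hermiteFun m x * partialDeriv i η x =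
    -∫ x, partialDeriv i (hermiteFun m) x * η x at h
  rw [h, hpH, ← integral_const_mul]
  simp only [mul_assoc]

/-- Both sides of the defining identity are expanded by Parseval; `hermiteCoeff_partialDeriv_div`
and the hypothesis make the two series agree after the shift `m = k + e_i`. -/
theorem isWeakDeriv_single_of_hermiteCoeff {d : ℕ} {i : Fin d} {f g : E d → ℝ}
    (hf : MemLp f 2 (gauss d)) (hg : MemLp g 2 (gauss d))
    (h : ∀ k, hermiteCoeff g k = √((k i : ℝ) + 1) * hermiteCoeff f (k + Pi.single i 1)) :
    IsWeakDeriv (Pi.single i 1) f g := by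
  refine ⟨locallyIntegrable_of_memLp_gauss hf, locallyIntegrable_of_memLp_gauss hg,
    fun η hη hc => ?_⟩
  rw [multiDeriv_single i hη, multiAbs_single, pow_one, integral_mul_eq_integral_gauss,
    integral_mul_eq_integral_gauss g]
  have h1 := hasSum_hermiteCoeff_mul hf (memLp_div_gaussDensity
    (contDiff_partialDeriv hη i).continuous (hasCompactSupport_partialDeriv hc i))
  have h2 := hasSum_hermiteCoeff_mul hg (memLp_div_gaussDensity hη.continuous hc)
  simp only [hermiteCoeff_partialDeriv_div i hη hc] at h1
  rw [← (add_left_injective (Pi.single i 1 : Fin d → ℕ)).hasSum_iff] at h1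
  · refine h1.unique ((h2.mul_left (-1)).congr_fun fun k => ?_)
    simp [h]
    ring
  -- Indices missed by the shift have `m i = 0`, and their terms carry the factor `√(m i)`.
  · intro m hm
    have : m i = 0 := by
      by_contra h0
      refine hm ⟨m - Pi.single i 1, ?_⟩
      funext j
      by_cases hj : j = i
      · subst hj; simp; omega
      · simp [hj]
    simp [this]

end

section

/-! ### Hermite coefficients of higher weak derivatives -/

/-- The weight `m! / (m - α)!` (zero unless `α ≤ m`). -/
def fallWeight {d : ℕ} (α m : Fin d → ℕ) : ℝ := ∏ j, ((m j).descFactorial (α j) : ℝ)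

theorem fallWeight_nonneg {d : ℕ} (α m : Fin d → ℕ) : 0 ≤ fallWeight α m :=
  Finset.prod_nonneg fun _ _ => Nat.cast_nonneg _

theorem fallWeight_zero {d : ℕ} (m : Fin d → ℕ) : fallWeight 0 m = 1 := by
  simp [fallWeight]

theorem fallWeight_add_single {d : ℕ} (α k : Fin d → ℕ) (i : Fin d) :
    fallWeight (α + Pi.single i 1) (k + (α + Pi.single i 1)) =
      ((k i : ℝ) + 1) * fallWeight α (k + Pi.single i 1 + α) := by
  unfold fallWeight
  have e : ∀ F : Fin d → ℝ, F i * ∏ j ∈ Finset.univ.erase i, F j = ∏ j, F j :=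
    fun F => Finset.mul_prod_erase Finset.univ F (Finset.mem_univ i)
  refine (e _).symm.trans (Eq.trans ?_ (congrArg _ (e _)))
  rw [← mul_assoc]
  congr 1
  · simp only [Pi.add_apply, Pi.single_eq_same]
    -- The new last factor of the falling factorial in coordinate `i` is `(k i + α i + 1) - α i`.
    rw [Nat.descFactorial_succ, show k i + (α i + 1) - α i = k i + 1 by omega,
      show k i + (α i + 1) = k i + 1 + α i by ring]
    push_cast; rfl
  · refine Finset.prod_congr rfl fun j hj => ?_
    simp [Finset.ne_of_mem_erase hj]

theorem apply_le_multiAbs {d : ℕ} (m : Fin d → ℕ) (j : Fin d) : m j ≤ multiAbs m :=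
  Finset.single_le_sum (f := m) (fun _ _ => Nat.zero_le _) (Finset.mem_univ j)

theorem fallWeight_le {d : ℕ} (α m : Fin d → ℕ) :
    fallWeight α m ≤ (multiAbs m : ℝ) ^ multiAbs α := by
  rw [fallWeight, multiAbs, multiAbs, ← Finset.prod_pow_eq_pow_sum]
  refine Finset.prod_le_prod (fun _ _ => Nat.cast_nonneg _) fun j _ => ?_
  have h := ((m j).descFactorial_le_pow (α j)).trans
    (Nat.pow_le_pow_left (apply_le_multiAbs m j) (α j))
  exact_mod_cast h

theorem fallWeight_eq_zero {d : ℕ} {α m : Fin d → ℕ} (h : ¬ α ≤ m) : fallWeight α m = 0 := by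
  simp only [Pi.le_def, not_forall, not_le] at h
  obtain ⟨j, hj⟩ := h
  exact Finset.prod_eq_zero (Finset.mem_univ j) (by simp [Nat.descFactorial_eq_zero_iff_lt.2 hj])

/-- Makes the reindexing `m = k + α` lossless, so sums for all `α` can be written over the same
index `m` and compared termwise. -/
theorem fallWeight_eq_zero_of_notMem_range {d : ℕ} {α m : Fin d → ℕ}
    (h : m ∉ Set.range fun k : Fin d → ℕ => k + α) : fallWeight α m = 0 :=
  fallWeight_eq_zero fun hle => h ⟨m - α, tsub_add_cancel_of_le hle⟩

theorem sqrt_fallWeight_step {d : ℕ} {f g h : E d → ℝ} {α : Fin d → ℕ} {i : Fin d}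
    (hg : ∀ k, hermiteCoeff g k = √(fallWeight α (k + α)) * hermiteCoeff f (k + α))
    (hh : ∀ k, hermiteCoeff h k = √((k i : ℝ) + 1) * hermiteCoeff g (k + Pi.single i 1))
    (k : Fin d → ℕ) :
    hermiteCoeff h k = √(fallWeight (α + Pi.single i 1) (k + (α + Pi.single i 1))) *
      hermiteCoeff f (k + (α + Pi.single i 1)) := by
  rw [hh, hg, fallWeight_add_single, Real.sqrt_mul (by positivity), mul_assoc,
    show k + (α + Pi.single i 1) = k + Pi.single i 1 + α by
      rw [add_assoc, add_comm α]]

/-- Induction on `|α|`, peeling off one coordinate derivative; the intermediate derivative exists in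
`L_2(γ)` because `f` lies in the Sobolev space. -/
theorem hermiteCoeff_of_isWeakDeriv {d n : ℕ} {f : E d → ℝ} (hf : f ∈ intSobolevSpace d n) :
    ∀ {N : ℕ}, N ≤ n → ∀ {α : Fin d → ℕ} {g : E d → ℝ}, multiAbs α = N → IsWeakDeriv α f g →
      MemLp g 2 (gauss d) →
      ∀ k, hermiteCoeff g k = √(fallWeight α (k + α)) * hermiteCoeff f (k + α) := by
  intro N
  induction N with
  | zero =>
    intro _ α g hα hg _ k
    have h0 : α = 0 := by
      funext j
      have := apply_le_multiAbs α j
      simp only [Pi.zero_apply]; omega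
    subst h0
    have := (gauss_absolutelyContinuous d).ae_eq (hg.ae_eq (isWeakDeriv_zero_self hf.1))
    rw [hermiteCoeff_congr this, fallWeight_zero]
    simp
  | succ N ih =>
    intro hN α g hα hg hg2
    obtain ⟨β, i, rfl, hβ⟩ := exists_eq_add_single hα
    obtain ⟨g', hg', hg'2⟩ := hf.2 β (by omega)
    have h1 := ih (by omega) hβ hg' hg'2
    exact sqrt_fallWeight_step h1
      (hermiteCoeff_of_isWeakDeriv_single hg'2 hg2 (hg'.add_single_iff.1 hg))

theorem summable_fallWeight_mul {d n : ℕ} {f : E d → ℝ}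
    (hs : Summable fun k : Fin d → ℕ => (1 + (multiAbs k : ℝ)) ^ n * hermiteCoeff f k ^ 2)
    {α : Fin d → ℕ} (hα : multiAbs α ≤ n) :
    Summable fun m => fallWeight α m * hermiteCoeff f m ^ 2 := by
  refine hs.of_nonneg_of_le (fun m => mul_nonneg (fallWeight_nonneg α m) (sq_nonneg _))
    fun m => mul_le_mul_of_nonneg_right ?_ (sq_nonneg _)
  calc fallWeight α m ≤ (multiAbs m : ℝ) ^ multiAbs α := fallWeight_le α m
    _ ≤ (1 + (multiAbs m : ℝ)) ^ multiAbs α := by gcongr; linarith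
    _ ≤ (1 + (multiAbs m : ℝ)) ^ n := pow_le_pow_right₀ (by simp) hα

/-- The derivative is built from its coefficients: they are square summable because `fallWeight` is
at most `(1 + |m|)^n`, and the resulting function is a derivative of the one obtained one order
lower. -/
theorem exists_isWeakDeriv_of_summable {d n : ℕ} {f : E d → ℝ} (hf : MemLp f 2 (gauss d))
    (hs : Summable fun k : Fin d → ℕ => (1 + (multiAbs k : ℝ)) ^ n * hermiteCoeff f k ^ 2) :
    ∀ {N : ℕ}, N ≤ n → ∀ {α : Fin d → ℕ}, multiAbs α = N →
      ∃ g, IsWeakDeriv α f g ∧ MemLp g 2 (gauss d) ∧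
        ∀ k, hermiteCoeff g k = √(fallWeight α (k + α)) * hermiteCoeff f (k + α) := by
  intro N
  induction N with
  | zero =>
    intro _ α hα
    have h0 : α = 0 := by
      funext j
      have := apply_le_multiAbs α j
      simp only [Pi.zero_apply]; omega
    subst h0
    exact ⟨f, isWeakDeriv_zero_self hf, hf, fun k => by rw [fallWeight_zero]; simp⟩
  | succ N ih =>
    intro hN α hα
    obtain ⟨β, i, rfl, hβ⟩ := exists_eq_add_single hα
    obtain ⟨g', hg', hg'2, hg'3⟩ := ih (by omega) hβ
    have hsum := (summable_fallWeight_mul hs (hα.trans_le hN)).comp_injective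
      (add_left_injective (β + Pi.single i 1))
    obtain ⟨g, hg, hgc⟩ := exists_memLp_hermiteCoeff_eq
      (c := fun k => √((k i : ℝ) + 1) * hermiteCoeff g' (k + Pi.single i 1)) (by
        refine hsum.congr fun k => ?_
        rw [hg'3, show k + Pi.single i 1 + β = k + (β + Pi.single i 1) by
          rw [add_assoc, add_comm β], mul_pow, mul_pow, Real.sq_sqrt (by positivity),
          Real.sq_sqrt (fallWeight_nonneg _ _)]
        simp only [Function.comp]
        rw [fallWeight_add_single, show k + Pi.single i 1 + β = k + (β + Pi.single i 1) by
          rw [add_assoc, add_comm β]]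
        ring)
    exact ⟨g, hg'.add_single_iff.2 (isWeakDeriv_single_of_hermiteCoeff hg'2 hg hgc), hg,
      sqrt_fallWeight_step hg'3 hgc⟩

theorem mem_intSobolevSpace_of_summable {d n : ℕ} {f : E d → ℝ} (hf : MemLp f 2 (gauss d))
    (hs : Summable fun k : Fin d → ℕ => (1 + (multiAbs k : ℝ)) ^ n * hermiteCoeff f k ^ 2) :
    f ∈ intSobolevSpace d n :=
  ⟨hf, fun _ hα => let ⟨g, h1, h2, _⟩ := exists_isWeakDeriv_of_summable hf hs hα rfl
    ⟨g, h1, h2⟩⟩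

theorem memLp_weakDeriv {d n : ℕ} {f : E d → ℝ} (hf : f ∈ intSobolevSpace d n)
    {α : Fin d → ℕ} (hα : multiAbs α ≤ n) : MemLp (weakDeriv α f) 2 (gauss d) := by
  obtain ⟨g, h1, h2⟩ := hf.2 α hα
  exact (memLp_congr_ae h1.weakDeriv_ae_eq).2 h2

theorem hermiteCoeff_weakDeriv_sq {d n : ℕ} {f : E d → ℝ} (hf : f ∈ intSobolevSpace d n)
    {α : Fin d → ℕ} (hα : multiAbs α ≤ n) (k : Fin d → ℕ) :
    hermiteCoeff (weakDeriv α f) k ^ 2 =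
      fallWeight α (k + α) * hermiteCoeff f (k + α) ^ 2 := by
  obtain ⟨g, h1, _⟩ := hf.2 α hα
  rw [hermiteCoeff_of_isWeakDeriv hf hα rfl (isWeakDeriv_weakDeriv ⟨g, h1⟩)
    (memLp_weakDeriv hf hα), mul_pow, Real.sq_sqrt (fallWeight_nonneg _ _)]

theorem hasSum_fallWeight_mul {d n : ℕ} {f : E d → ℝ} (hf : f ∈ intSobolevSpace d n)
    {α : Fin d → ℕ} (hα : multiAbs α ≤ n) :
    HasSum (fun m => fallWeight α m * hermiteCoeff f m ^ 2)
      ((eLpNorm (weakDeriv α f) 2 (gauss d)).toReal ^ 2) := by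
  have h := hasSum_hermiteCoeff_sq (memLp_weakDeriv hf hα)
  simp only [hermiteCoeff_weakDeriv_sq hf hα] at h
  rw [eLpNorm_toReal_sq (memLp_weakDeriv hf hα)]
  refine ((add_left_injective α).hasSum_iff fun m hm => ?_).1 h
  rw [fallWeight_eq_zero_of_notMem_range hm, zero_mul]

/-- With `m = k + α` the factor `|k|^σ` becomes `(|m| - n)^σ`. Truncated subtraction does no harm,
since `fallWeight α m = 0` when `|m| < n`. -/
theorem lintegral_weakDeriv_ouKernel {d n : ℕ} {f : E d → ℝ} (hf : f ∈ intSobolevSpace d n)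
    {α : Fin d → ℕ} (hα : multiAbs α = n) {σ : ℝ} (hσ : 0 < σ) :
    ∫⁻ x, ∫⁻ y, ENNReal.ofReal (|weakDeriv α f x - weakDeriv α f y| ^ 2)
      * ouKernel (2 * σ) x y ∂(gauss d) ∂(gauss d) =
      2 * fracIntegral σ 1 * ∑' m, ENNReal.ofReal
        (((multiAbs m - n : ℕ) : ℝ) ^ σ * (fallWeight α m * hermiteCoeff f m ^ 2)) := by
  rw [lintegral_ouKernel hσ (memLp_weakDeriv hf hα.le)]
  congr 1
  rw [← (add_left_injective α).tsum_eq (f := fun m => ENNReal.ofReal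
        (((multiAbs m - n : ℕ) : ℝ) ^ σ * (fallWeight α m * hermiteCoeff f m ^ 2)))]
  · refine tsum_congr fun k => ?_
    rw [hermiteCoeff_weakDeriv_sq hf hα.le, multiAbs_add, hα, Nat.add_sub_cancel]
  · intro m hm
    by_contra h
    exact hm (by simp [fallWeight_eq_zero_of_notMem_range h])

/-! ### Comparison of the weights -/

theorem exists_multiAbs_le_mul {d : ℕ} (hd : 0 < d) (m : Fin d → ℕ) :
    ∃ i, multiAbs m ≤ d * m i := by
  have : Nonempty (Fin d) := ⟨⟨0, hd⟩⟩
  obtain ⟨i, _, hi⟩ := Finset.exists_max_image Finset.univ m Finset.univ_nonempty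
  refine ⟨i, ?_⟩
  have := Finset.sum_le_card_nsmul Finset.univ m (m i) hi
  simpa [multiAbs] using this

theorem multiAbs_pi_single {d : ℕ} (i : Fin d) (n : ℕ) :
    multiAbs (Pi.single i n : Fin d → ℕ) = n := by
  simp [multiAbs]

theorem fallWeight_pi_single {d : ℕ} (i : Fin d) (n : ℕ) (m : Fin d → ℕ) :
    fallWeight (Pi.single i n) m = ((m i).descFactorial n : ℝ) := by
  rw [fallWeight, Finset.prod_eq_single i]
  · simp
  · intro j _ hj; simp [hj]
  · simp

/-- For small `|m|` the left side is bounded and the summand `1` suffices; the sum alone may vanish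
there. For large `|m|` the single multi-index `n e_i`, with `m_i` maximal, already has a weight of
the right order. -/
theorem rpow_le_sum_fallWeight (d n : ℕ) {σ : ℝ} (hσ : 0 ≤ σ) (m : Fin d → ℕ) :
    (1 + (multiAbs m : ℝ)) ^ ((n : ℝ) + σ) ≤ (2 * (d + 1) * (2 * n + 1) : ℝ) ^ ((n : ℝ) + σ) *
      (1 + ∑ α ∈ multiEQ d n, ((multiAbs m - n : ℕ) : ℝ) ^ σ * fallWeight α m) := by
  have hs : 0 ≤ (n : ℝ) + σ := by positivity
  have hterm : ∀ α : Fin d → ℕ, 0 ≤ ((multiAbs m - n : ℕ) : ℝ) ^ σ * fallWeight α m :=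
    fun α => mul_nonneg (by positivity) (fallWeight_nonneg α m)
  have hsum : 0 ≤ ∑ α ∈ multiEQ d n, ((multiAbs m - n : ℕ) : ℝ) ^ σ * fallWeight α m :=
    Finset.sum_nonneg fun α _ => hterm α
  -- Beyond this threshold the largest entry exceeds `2 n + 1`, so `m_i - n` and all factors of the
  -- falling factorial are at least `X = (1 + m_i) / 2`.
  by_cases hm : multiAbs m ≤ d * (2 * n + 1)
  · have hm' : (multiAbs m : ℝ) ≤ d * (2 * n + 1) := by exact_mod_cast hm
    calc (1 + (multiAbs m : ℝ)) ^ ((n : ℝ) + σ)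
        ≤ (2 * (d + 1) * (2 * n + 1) : ℝ) ^ ((n : ℝ) + σ) := by
          refine Real.rpow_le_rpow (by positivity) ?_ hs
          nlinarith [Nat.cast_nonneg (α := ℝ) d, Nat.cast_nonneg (α := ℝ) n,
            mul_nonneg (Nat.cast_nonneg (α := ℝ) d) (Nat.cast_nonneg (α := ℝ) n)]
      _ ≤ _ := le_mul_of_one_le_right (by positivity) (by linarith)
  · push Not at hm
    have hd : 0 < d := by
      rcases Nat.eq_zero_or_pos d with rfl | h
      · simp [multiAbs] at hm
      · exact h
    obtain ⟨i, hi⟩ := exists_multiAbs_le_mul hd m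
    have hmi : 2 * n + 1 < m i := lt_of_mul_lt_mul_left (hm.trans_le hi) (Nat.zero_le d)
    set X : ℝ := (1 + (m i : ℝ)) / 2 with hX
    have hmi' : (2 * n + 1 : ℝ) < m i := by exact_mod_cast hmi
    have hX0 : 0 < X := by positivity
    have h1 : 1 + (multiAbs m : ℝ) ≤ (2 * (d + 1) * (2 * n + 1) : ℝ) * X := by
      have hi' : (multiAbs m : ℝ) ≤ d * m i := by exact_mod_cast hi
      calc 1 + (multiAbs m : ℝ) ≤ (d + 1) * (1 + m i) := by
            nlinarith [Nat.cast_nonneg (α := ℝ) d, Nat.cast_nonneg (α := ℝ) (m i)]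
        _ = 2 * (d + 1) * X := by rw [hX]; ring
        _ ≤ (2 * (d + 1) * (2 * n + 1) : ℝ) * X := by
            refine mul_le_mul_of_nonneg_right (le_mul_of_one_le_right (by positivity) ?_) hX0.le
            linarith [Nat.cast_nonneg (α := ℝ) n]
    have h2 : X ^ n ≤ fallWeight (Pi.single i n) m := by
      rw [fallWeight_pi_single]
      have h3 : ((m i + 1 - n : ℕ) : ℝ) ^ n ≤ ((m i).descFactorial n : ℝ) := by
        exact_mod_cast Nat.pow_sub_le_descFactorial (m i) n
      refine le_trans ?_ h3
      refine pow_le_pow_left₀ hX0.le ?_ n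
      rw [Nat.cast_sub (by omega)]
      push_cast
      rw [hX]; linarith
    have h3 : X ^ σ ≤ ((multiAbs m - n : ℕ) : ℝ) ^ σ := by
      refine Real.rpow_le_rpow hX0.le ?_ hσ
      have h4 : m i - n ≤ multiAbs m - n := Nat.sub_le_sub_right (apply_le_multiAbs m i) n
      have h5 : ((m i - n : ℕ) : ℝ) ≤ ((multiAbs m - n : ℕ) : ℝ) := by exact_mod_cast h4
      refine le_trans ?_ h5
      rw [Nat.cast_sub (by omega), hX]
      linarith
    calc (1 + (multiAbs m : ℝ)) ^ ((n : ℝ) + σ)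
        ≤ ((2 * (d + 1) * (2 * n + 1) : ℝ) * X) ^ ((n : ℝ) + σ) :=
          Real.rpow_le_rpow (by positivity) h1 hs
      _ = (2 * (d + 1) * (2 * n + 1) : ℝ) ^ ((n : ℝ) + σ) * (X ^ σ * X ^ n) := by
          rw [Real.mul_rpow (by positivity) hX0.le, Real.rpow_add hX0, Real.rpow_natCast]
          ring
      _ ≤ _ := by
          refine mul_le_mul_of_nonneg_left ?_ (by positivity)
          have h6 := Finset.single_le_sum (f := fun α : Fin d → ℕ =>
            ((multiAbs m - n : ℕ) : ℝ) ^ σ * fallWeight α m) (fun α _ => hterm α)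
            (mem_multiEQ.2 (multiAbs_pi_single i n))
          have h7 : X ^ σ * X ^ n ≤
              ((multiAbs m - n : ℕ) : ℝ) ^ σ * fallWeight (Pi.single i n) m := by gcongr
          linarith

theorem rpow_mul_fallWeight_le {d n : ℕ} {σ : ℝ} (hσ : 0 ≤ σ) {α : Fin d → ℕ}
    (hα : multiAbs α = n) (m : Fin d → ℕ) :
    ((multiAbs m - n : ℕ) : ℝ) ^ σ * fallWeight α m ≤
      (1 + (multiAbs m : ℝ)) ^ ((n : ℝ) + σ) := by
  have h1 : ((multiAbs m - n : ℕ) : ℝ) ≤ 1 + (multiAbs m : ℝ) := by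
    have : multiAbs m - n ≤ 1 + multiAbs m := by omega
    exact_mod_cast this
  have h2 : fallWeight α m ≤ (1 + (multiAbs m : ℝ)) ^ n := by
    refine (fallWeight_le α m).trans ?_
    rw [hα]
    gcongr; linarith
  rw [Real.rpow_add (by positivity), Real.rpow_natCast, mul_comm]
  have := fallWeight_nonneg α m
  gcongr

end

section

/-! ### Comparison of the norms -/

theorem mem_hermiteSpace_iff {d : ℕ} {s : ℝ} {f : E d → ℝ} :
    f ∈ hermiteSpace d s ↔ MemLp f 2 (gauss d) ∧
      Summable fun k : Fin d → ℕ => (1 + (multiAbs k : ℝ)) ^ s * hermiteCoeff f k ^ 2 := by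
  simp only [hermiteSpace, Set.mem_ofPred_eq, sq_abs]
  exact ⟨fun h => ⟨h.1, h.2.2⟩, fun h => ⟨h.1, tendsto_eLpNorm_hermite_sum h.1, h.2⟩⟩

theorem hermiteNorm_eq {d : ℕ} (s : ℝ) (f : E d → ℝ) :
    hermiteNorm d s f =
      √(∑' k : Fin d → ℕ, (1 + (multiAbs k : ℝ)) ^ s * hermiteCoeff f k ^ 2) := by
  simp only [hermiteNorm, sq_abs]

/-- The terms of the weighted series attached to the derivative `D^α` of order `n`. -/
def fracTerm {d : ℕ} (n : ℕ) (σ : ℝ) (f : E d → ℝ) (α m : Fin d → ℕ) : ℝ :=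
  ((multiAbs m - n : ℕ) : ℝ) ^ σ * (fallWeight α m * hermiteCoeff f m ^ 2)

theorem fracTerm_nonneg {d : ℕ} (n : ℕ) (σ : ℝ) (f : E d → ℝ) (α m : Fin d → ℕ) :
    0 ≤ fracTerm n σ f α m :=
  mul_nonneg (by positivity) (mul_nonneg (fallWeight_nonneg α m) (sq_nonneg _))

theorem fracTerm_le {d n : ℕ} {σ : ℝ} (hσ : 0 ≤ σ) (f : E d → ℝ) {α : Fin d → ℕ}
    (hα : multiAbs α = n) (m : Fin d → ℕ) :
    fracTerm n σ f α m ≤ (1 + (multiAbs m : ℝ)) ^ ((n : ℝ) + σ) * hermiteCoeff f m ^ 2 := by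
  rw [fracTerm, ← mul_assoc]
  exact mul_le_mul_of_nonneg_right (rpow_mul_fallWeight_le hσ hα m) (sq_nonneg _)

/-- The pointwise weight bound summed against `f̂(k)²`: its summand `1` becomes the `L_2` norm by
Parseval. Taking `σ = 0` covers integer orders. -/
theorem summable_sq_of_summable_fracTerm {d n : ℕ} {σ : ℝ} (hσ : 0 ≤ σ) {f : E d → ℝ}
    (hf : MemLp f 2 (gauss d)) (hs : ∀ α ∈ multiEQ d n, Summable (fracTerm n σ f α)) :
    (Summable fun k : Fin d → ℕ =>
      (1 + (multiAbs k : ℝ)) ^ ((n : ℝ) + σ) * hermiteCoeff f k ^ 2) ∧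
    ∑' k : Fin d → ℕ, (1 + (multiAbs k : ℝ)) ^ ((n : ℝ) + σ) * hermiteCoeff f k ^ 2 ≤
      (2 * (d + 1) * (2 * n + 1) : ℝ) ^ ((n : ℝ) + σ) *
        (∫ x, f x ^ 2 ∂(gauss d) + ∑ α ∈ multiEQ d n, ∑' m, fracTerm n σ f α m) := by
  have h1 := ((hasSum_hermiteCoeff_sq hf).add
    (hasSum_sum fun α hα => (hs α hα).hasSum)).mul_left
      ((2 * (d + 1) * (2 * n + 1) : ℝ) ^ ((n : ℝ) + σ))
  have hle : ∀ k : Fin d → ℕ,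
      (1 + (multiAbs k : ℝ)) ^ ((n : ℝ) + σ) * hermiteCoeff f k ^ 2 ≤
        (2 * (d + 1) * (2 * n + 1) : ℝ) ^ ((n : ℝ) + σ) *
          (hermiteCoeff f k ^ 2 + ∑ α ∈ multiEQ d n, fracTerm n σ f α k) := by
    intro k
    refine (mul_le_mul_of_nonneg_right (rpow_le_sum_fallWeight d n hσ k)
      (sq_nonneg _)).trans (le_of_eq ?_)
    rw [mul_assoc, add_mul, one_mul, Finset.sum_mul]
    simp only [fracTerm, mul_assoc]
  have h2 := h1.summable.of_nonneg_of_le (fun k => by positivity) hle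
  exact ⟨h2, (h2.tsum_le_tsum hle h1.summable).trans_eq h1.tsum_eq⟩

theorem intSobolevNorm_sq {d n : ℕ} (f : E d → ℝ) :
    intSobolevNorm d n f ^ 2 =
      ∑ α ∈ multiLE d n, (eLpNorm (weakDeriv α f) 2 (gauss d)).toReal ^ 2 :=
  Real.sq_sqrt (Finset.sum_nonneg fun _ _ => sq_nonneg _)

theorem integral_sq_le_intSobolevNorm_sq {d n : ℕ} {f : E d → ℝ} (hf : f ∈ intSobolevSpace d n) :
    ∫ x, f x ^ 2 ∂(gauss d) ≤ intSobolevNorm d n f ^ 2 := by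
  rw [intSobolevNorm_sq]
  have h0 : multiAbs (0 : Fin d → ℕ) ≤ n := by simp [multiAbs]
  have h1 := hasSum_fallWeight_mul hf h0
  simp only [fallWeight_zero, one_mul] at h1
  rw [(hasSum_hermiteCoeff_sq hf.1).unique h1]
  exact Finset.single_le_sum
    (f := fun α : Fin d → ℕ => (eLpNorm (weakDeriv α f) 2 (gauss d)).toReal ^ 2)
    (fun _ _ => sq_nonneg _) (mem_multiLE.2 h0)

theorem summable_pow_of_summable_rpow {d n : ℕ} {σ : ℝ} (hσ : 0 ≤ σ) {f : E d → ℝ}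
    (hs : Summable fun k : Fin d → ℕ =>
      (1 + (multiAbs k : ℝ)) ^ ((n : ℝ) + σ) * hermiteCoeff f k ^ 2) :
    Summable fun k : Fin d → ℕ => (1 + (multiAbs k : ℝ)) ^ n * hermiteCoeff f k ^ 2 := by
  refine hs.of_nonneg_of_le (fun k => by positivity) fun k => ?_
  refine mul_le_mul_of_nonneg_right ?_ (sq_nonneg _)
  rw [← Real.rpow_natCast]
  exact Real.rpow_le_rpow_of_exponent_le (by simp) (by linarith)

theorem intSobolevNorm_sq_le {d n : ℕ} {σ : ℝ} (hσ : 0 ≤ σ) {f : E d → ℝ}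
    (hf : f ∈ intSobolevSpace d n)
    (hs : Summable fun k : Fin d → ℕ =>
      (1 + (multiAbs k : ℝ)) ^ ((n : ℝ) + σ) * hermiteCoeff f k ^ 2) :
    intSobolevNorm d n f ^ 2 ≤ (multiLE d n).card *
      ∑' k : Fin d → ℕ, (1 + (multiAbs k : ℝ)) ^ ((n : ℝ) + σ) * hermiteCoeff f k ^ 2 := by
  rw [intSobolevNorm_sq, ← nsmul_eq_mul]
  refine Finset.sum_le_card_nsmul _ _ _ fun α hα => ?_
  have hα' := mem_multiLE.1 hα
  refine hasSum_le (fun m => ?_) (hasSum_fallWeight_mul hf hα') hs.hasSum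
  refine mul_le_mul_of_nonneg_right ?_ (sq_nonneg _)
  calc fallWeight α m ≤ (multiAbs m : ℝ) ^ multiAbs α := fallWeight_le α m
    _ ≤ (1 + (multiAbs m : ℝ)) ^ multiAbs α := by gcongr; linarith
    _ = (1 + (multiAbs m : ℝ)) ^ (multiAbs α : ℝ) := (Real.rpow_natCast _ _).symm
    _ ≤ (1 + (multiAbs m : ℝ)) ^ ((n : ℝ) + σ) := by
        refine Real.rpow_le_rpow_of_exponent_le (by simp) ?_
        have : (multiAbs α : ℝ) ≤ n := by exact_mod_cast hα'
        linarith

theorem intSobolevSpace_eq_hermiteSpace (d n : ℕ) :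
    intSobolevSpace d n = hermiteSpace d n ∧ ∃ c C : ℝ, 0 < c ∧ 0 < C ∧
      ∀ f ∈ intSobolevSpace d n, c * hermiteNorm d n f ≤ intSobolevNorm d n f ∧
        intSobolevNorm d n f ≤ C * hermiteNorm d n f := by
  have hcast : ∀ f : E d → ℝ, (fun k : Fin d → ℕ =>
      (1 + (multiAbs k : ℝ)) ^ (n : ℝ) * hermiteCoeff f k ^ 2) = fun k : Fin d → ℕ =>
      (1 + (multiAbs k : ℝ)) ^ ((n : ℝ) + 0) * hermiteCoeff f k ^ 2 := by
    simp
  have hterm : ∀ {f : E d → ℝ}, f ∈ intSobolevSpace d n → ∀ α ∈ multiEQ d n,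
      HasSum (fracTerm n 0 f α) ((eLpNorm (weakDeriv α f) 2 (gauss d)).toReal ^ 2) := by
    intro f hf α hα
    have := hasSum_fallWeight_mul hf (mem_multiEQ.1 hα).le
    refine this.congr_fun fun m => ?_
    -- Since `x ^ (0 : ℝ) = 1` even at `x = 0`, the factor in front of `fallWeight` disappears for
    -- every `m`.
    simp [fracTerm]
  have hsub : ∀ f ∈ intSobolevSpace d n, Summable fun k : Fin d → ℕ =>
      (1 + (multiAbs k : ℝ)) ^ ((n : ℝ) + 0) * hermiteCoeff f k ^ 2 := fun f hf =>
    (summable_sq_of_summable_fracTerm le_rfl hf.1 fun α hα => (hterm hf α hα).summable).1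
  refine ⟨Set.Subset.antisymm (fun f hf => ?_) (fun f hf => ?_), ?_⟩
  · rw [mem_hermiteSpace_iff, hcast]
    exact ⟨hf.1, hsub f hf⟩
  · rw [mem_hermiteSpace_iff, hcast] at hf
    exact mem_intSobolevSpace_of_summable hf.1 (summable_pow_of_summable_rpow le_rfl hf.2)
  · set D : ℝ := (2 * (d + 1) * (2 * n + 1) : ℝ) ^ ((n : ℝ) + 0) with hD
    have hD0 : 0 < D := by positivity
    -- The `2` counts the `L_2` term and the top-order terms, each at most the squared Sobolev norm.
    -- The `+ 1` makes positivity immediate.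
    refine ⟨(√(D * 2))⁻¹, √((multiLE d n).card) + 1, by positivity, by positivity,
      fun f hf => ?_⟩
    have hN0 : 0 ≤ intSobolevNorm d n f := Real.sqrt_nonneg _
    rw [hermiteNorm_eq, hcast]
    constructor
    · rw [inv_mul_le_iff₀ (by positivity)]
      refine Real.sqrt_le_iff.2 ⟨by positivity, ?_⟩
      rw [mul_pow, Real.sq_sqrt (by positivity)]
      refine (summable_sq_of_summable_fracTerm le_rfl hf.1
        fun α hα => (hterm hf α hα).summable).2.trans ?_
      rw [mul_assoc D]
      refine mul_le_mul_of_nonneg_left ?_ hD0.le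
      have h1 := integral_sq_le_intSobolevNorm_sq hf
      have h2 : ∑ α ∈ multiEQ d n, ∑' m, fracTerm n 0 f α m ≤ intSobolevNorm d n f ^ 2 := by
        rw [intSobolevNorm_sq, Finset.sum_congr rfl fun α hα => (hterm hf α hα).tsum_eq]
        exact Finset.sum_le_sum_of_subset_of_nonneg
          (fun α hα => mem_multiLE.2 (mem_multiEQ.1 hα).le) fun _ _ _ => sq_nonneg _
      linarith
    · refine (abs_le_of_sq_le_sq' ?_ (by positivity)).2
      rw [mul_pow, Real.sq_sqrt (tsum_nonneg fun k => by positivity)]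
      refine (intSobolevNorm_sq_le le_rfl hf (hsub f hf)).trans ?_
      refine mul_le_mul_of_nonneg_right ?_ (tsum_nonneg fun k => by positivity)
      have := Real.sq_sqrt (Nat.cast_nonneg (α := ℝ) (multiLE d n).card)
      nlinarith [Real.sqrt_nonneg ((multiLE d n).card : ℝ)]

/-! ### Non-integer orders. -/

section Fractional

variable {d : ℕ} {s : ℝ} {f : E d → ℝ}

theorem fracSeminorm_eq (hσ : 0 < Int.fract s) (hf : f ∈ intSobolevSpace d ⌊s⌋₊) :
    fracSeminorm d s f = ∑ α ∈ multiEQ d ⌊s⌋₊, (2 * fracIntegral (Int.fract s) 1 *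
      ∑' m, ENNReal.ofReal (fracTerm ⌊s⌋₊ (Int.fract s) f α m)) ^ (1 / 2 : ℝ) := by
  refine Finset.sum_congr rfl fun α hα => ?_
  rw [lintegral_weakDeriv_ouKernel hf (mem_multiEQ.1 hα) hσ]
  rfl

/-- The kernel constant is nonzero, so an infinite sum would make its summand in the seminorm
infinite. -/
theorem summable_fracTerm_of_fracSeminorm_lt_top (hσ : 0 < Int.fract s)
    (hf : f ∈ intSobolevSpace d ⌊s⌋₊) (h : fracSeminorm d s f < ⊤) :
    ∀ α ∈ multiEQ d ⌊s⌋₊, Summable (fracTerm ⌊s⌋₊ (Int.fract s) f α) := by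
  intro α hα
  rw [fracSeminorm_eq hσ hf, ENNReal.sum_lt_top] at h
  have h1 := (ENNReal.rpow_lt_top_iff_of_pos (by norm_num)).1 (h α hα)
  have h2 : 2 * fracIntegral (Int.fract s) 1 ≠ 0 :=
    mul_ne_zero two_ne_zero (fracIntegral_one_ne_zero _)
  have h3 : ∑' m, ENNReal.ofReal (fracTerm ⌊s⌋₊ (Int.fract s) f α m) ≠ ⊤ := fun h4 => by
    rw [h4, ENNReal.mul_top h2] at h1
    exact lt_irrefl _ h1
  refine (ENNReal.summable_toReal h3).congr fun m => ?_
  rw [ENNReal.toReal_ofReal (fracTerm_nonneg _ _ _ _ _)]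

theorem fracSeminorm_eq_ofReal (hσ : 0 < Int.fract s) (hf : f ∈ intSobolevSpace d ⌊s⌋₊)
    (h : ∀ α ∈ multiEQ d ⌊s⌋₊, Summable (fracTerm ⌊s⌋₊ (Int.fract s) f α)) :
    fracSeminorm d s f = ENNReal.ofReal (∑ α ∈ multiEQ d ⌊s⌋₊,
      √((2 * fracIntegral (Int.fract s) 1).toReal *
        ∑' m, fracTerm ⌊s⌋₊ (Int.fract s) f α m)) := by
  have hJ : 2 * fracIntegral (Int.fract s) 1 ≠ ⊤ :=
    ENNReal.mul_ne_top (by norm_num) (fracIntegral_one_ne_top hσ (Int.fract_lt_one s))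
  rw [fracSeminorm_eq hσ hf, ENNReal.ofReal_sum_of_nonneg fun _ _ => Real.sqrt_nonneg _]
  refine Finset.sum_congr rfl fun α hα => ?_
  have h0 : 0 ≤ ∑' m, fracTerm ⌊s⌋₊ (Int.fract s) f α m :=
    tsum_nonneg fun m => fracTerm_nonneg _ _ _ _ _
  rw [← ENNReal.ofReal_tsum_of_nonneg (fracTerm_nonneg _ _ _ _) (h α hα), Real.sqrt_eq_rpow,
    ← ENNReal.ofReal_rpow_of_nonneg (by positivity) (by norm_num),
    ENNReal.ofReal_mul ENNReal.toReal_nonneg, ENNReal.ofReal_toReal hJ]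

theorem fractional_sobolevSpace_eq_hermiteSpace (d : ℕ) {s : ℝ} (hs : 0 < s)
    (hσ : 0 < Int.fract s) :
    sobolevSpace d s = hermiteSpace d s ∧ ∃ c C : ℝ, 0 < c ∧ 0 < C ∧
      ∀ f ∈ sobolevSpace d s, c * hermiteNorm d s f ≤ sobolevNorm d s f ∧
        sobolevNorm d s f ≤ C * hermiteNorm d s f := by
  set n := ⌊s⌋₊ with hn
  set σ := Int.fract s with hσdef
  have hsn : (n : ℝ) + σ = s := by
    rw [hn, hσdef, natCast_floor_eq_intCast_floor hs.le, Int.floor_add_fract]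
  have hJ : 2 * fracIntegral σ 1 ≠ ⊤ :=
    ENNReal.mul_ne_top (by norm_num) (fracIntegral_one_ne_top hσ (Int.fract_lt_one s))
  set j : ℝ := (2 * fracIntegral σ 1).toReal with hj
  have hj0 : 0 < j := ENNReal.toReal_pos
    (mul_ne_zero two_ne_zero (fracIntegral_one_ne_zero _)) hJ
  have hterm : ∀ f ∈ sobolevSpace d s, ∀ α ∈ multiEQ d n, Summable (fracTerm n σ f α) :=
    fun f hf => summable_fracTerm_of_fracSeminorm_lt_top hσ hf.1 (hf.2 hσ.ne')
  have hsum : ∀ f ∈ sobolevSpace d s, Summable fun k : Fin d → ℕ =>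
      (1 + (multiAbs k : ℝ)) ^ ((n : ℝ) + σ) * hermiteCoeff f k ^ 2 := fun f hf =>
    (summable_sq_of_summable_fracTerm hσ.le hf.1.1 (hterm f hf)).1
  refine ⟨Set.Subset.antisymm (fun f hf => ?_) (fun f hf => ?_), ?_⟩
  · rw [mem_hermiteSpace_iff]
    conv in _ ^ s => rw [← hsn]
    exact ⟨hf.1.1, hsum f hf⟩
  · rw [mem_hermiteSpace_iff] at hf
    conv at hf in _ ^ s => rw [← hsn]
    have hi := mem_intSobolevSpace_of_summable hf.1 (summable_pow_of_summable_rpow hσ.le hf.2)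
    refine ⟨hi, fun _ => ?_⟩
    rw [fracSeminorm_eq_ofReal hσ hi fun α hα => hf.2.of_nonneg_of_le
      (fracTerm_nonneg _ _ _ _) (fracTerm_le hσ.le f (mem_multiEQ.1 hα))]
    exact ENNReal.ofReal_lt_top
  · set D : ℝ := (2 * (d + 1) * (2 * n + 1) : ℝ) ^ ((n : ℝ) + σ) with hD
    have hD0 : 0 < D := by positivity
    set A : ℝ := ((multiEQ d n).card : ℝ) with hA
    have hA0 : 0 ≤ A := Nat.cast_nonneg _
    -- Let `P` be the seminorm, a sum of `A` roots `√(j · sum)`. Each of the `A` sums is at most `P²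
    -- / j`, which gives `A / j`; conversely each root is at most `√j` times the Hermite norm, which
    -- gives `A * √j`.
    refine ⟨(√(D * (1 + A / j)))⁻¹, √((multiLE d n).card) + A * √j + 1, by positivity,
      by positivity, fun f hf => ?_⟩
    have hN0 : 0 ≤ intSobolevNorm d n f := Real.sqrt_nonneg _
    have hQ0 : ∀ α, 0 ≤ ∑' m, fracTerm n σ f α m :=
      fun α => tsum_nonneg fun m => fracTerm_nonneg _ _ _ _ _
    set H2 : ℝ := ∑' k : Fin d → ℕ,
      (1 + (multiAbs k : ℝ)) ^ ((n : ℝ) + σ) * hermiteCoeff f k ^ 2 with hH2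
    have hH20 : 0 ≤ H2 := tsum_nonneg fun k => by positivity
    have hHn : hermiteNorm d s f = √H2 := by
      rw [hermiteNorm_eq, hH2, hsn]
    set P : ℝ := ∑ α ∈ multiEQ d n, √(j * ∑' m, fracTerm n σ f α m) with hP
    have hP0 : 0 ≤ P := Finset.sum_nonneg fun _ _ => Real.sqrt_nonneg _
    have hSn : sobolevNorm d s f = intSobolevNorm d n f + P := by
      rw [sobolevNorm, if_neg hσ.ne', fracSeminorm_eq_ofReal hσ hf.1 (hterm f hf),
        ENNReal.toReal_ofReal hP0]
    rw [hSn, hHn]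
    constructor
    · rw [inv_mul_le_iff₀ (by positivity)]
      refine Real.sqrt_le_iff.2 ⟨by positivity, ?_⟩
      rw [mul_pow, Real.sq_sqrt (by positivity)]
      refine (summable_sq_of_summable_fracTerm hσ.le hf.1.1 (hterm f hf)).2.trans ?_
      rw [mul_assoc D]
      refine mul_le_mul_of_nonneg_left ?_ hD0.le
      have h1 := integral_sq_le_intSobolevNorm_sq hf.1
      have h2 : ∑ α ∈ multiEQ d n, ∑' m, fracTerm n σ f α m ≤ A * (P ^ 2 / j) := by
        rw [hA, ← nsmul_eq_mul]
        refine Finset.sum_le_card_nsmul _ _ _ fun α hα => ?_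
        rw [le_div_iff₀ hj0, mul_comm, ← Real.sq_sqrt (mul_nonneg hj0.le (hQ0 α))]
        refine pow_le_pow_left₀ (Real.sqrt_nonneg _) ?_ 2
        exact Finset.single_le_sum (f := fun α => √(j * ∑' m, fracTerm n σ f α m))
          (fun _ _ => Real.sqrt_nonneg _) hα
      have h3 : A * (P ^ 2 / j) = A / j * P ^ 2 := by ring
      have h4 : 0 ≤ A / j := by positivity
      have h5 : P ^ 2 ≤ (intSobolevNorm d n f + P) ^ 2 := by nlinarith
      have h6 : intSobolevNorm d n f ^ 2 ≤ (intSobolevNorm d n f + P) ^ 2 := by nlinarith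
      have h7 := mul_le_mul_of_nonneg_left h5 h4
      linarith
    · have h1 : intSobolevNorm d n f ≤ √((multiLE d n).card) * √H2 := by
        rw [← Real.sqrt_mul (Nat.cast_nonneg _)]
        exact Real.le_sqrt_of_sq_le (intSobolevNorm_sq_le hσ.le hf.1 (hsum f hf))
      have h2 : P ≤ A * (√j * √H2) := by
        rw [hA, ← nsmul_eq_mul]
        refine Finset.sum_le_card_nsmul _ _ _ fun α hα => ?_
        rw [← Real.sqrt_mul hj0.le]
        refine Real.sqrt_le_sqrt (mul_le_mul_of_nonneg_left ?_ hj0.le)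
        exact (hterm f hf α hα).tsum_le_tsum (fracTerm_le hσ.le f (mem_multiEQ.1 hα))
          (hsum f hf)
      have h3 := Real.sqrt_nonneg H2
      nlinarith

end Fractional

end

/-! ### Integer and fractional orders combined. -/

theorem sobolevSpace_eq_hermiteSpace (d : ℕ) (s : ℝ) (hs : 0 < s) :
    sobolevSpace d s = hermiteSpace d s ∧
    ∃ c C : ℝ, 0 < c ∧ 0 < C ∧ ∀ f ∈ sobolevSpace d s,
      c * hermiteNorm d s f ≤ sobolevNorm d s f ∧
      sobolevNorm d s f ≤ C * hermiteNorm d s f := by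
  rcases (Int.fract_nonneg s).eq_or_lt with h | h
  · have hsn : ((⌊s⌋₊ : ℕ) : ℝ) = s := by
      rw [natCast_floor_eq_intCast_floor hs.le]
      linarith [Int.floor_add_fract s]
    have hspace : sobolevSpace d s = intSobolevSpace d ⌊s⌋₊ := by
      ext f
      simp [sobolevSpace, ← h]
    have hnorm : ∀ f, sobolevNorm d s f = intSobolevNorm d ⌊s⌋₊ f := fun f => by
      rw [sobolevNorm, if_pos h.symm]
    have := intSobolevSpace_eq_hermiteSpace d ⌊s⌋₊
    rw [hsn] at this
    simpa only [hspace, hnorm] using this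
  · exact fractional_sobolevSpace_eq_hermiteSpace d hs h

end GaussianSobolev

end

theorem mainTheorem7 (d : ℕ) (s : ℝ) (hs : 0 < s) :
    GaussianSobolev.sobolevSpace d s = GaussianSobolev.hermiteSpace d s ∧
    ∃ c C : ℝ, 0 < c ∧ 0 < C ∧ ∀ f ∈ GaussianSobolev.sobolevSpace d s,
      c * GaussianSobolev.hermiteNorm d s f ≤ GaussianSobolev.sobolevNorm d s f ∧
      GaussianSobolev.sobolevNorm d s f ≤ C * GaussianSobolev.hermiteNorm d s f :=
  GaussianSobolev.sobolevSpace_eq_hermiteSpace d s hs
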